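/- For a field $F$ and a simple graph $G$ on $\{1,\dots,n\}$, the connected subgraph arrangement $\mathcal A_G(F)$ is the set of all hyperplanes $H_I=\ker\sum_{i\in I}x_i$ in $F^n$, where $\emptyset\ne I\subseteq\{1,\dots,n\}$ and the induced subgraph $G[I]$ is connected; write $\mathcal A_G=\mathcal A_G(\mathbb Q)$. Let $n\ge 1$ and let $C_n$ be the cycle graph on $n$ vertices ($C_1$ and $C_2$ being the complete graphs $K_1$ and $K_2$). The type-$A$ Shi arrangement in $\mathbb Q^n$ consists of the affine hyperplanes $x_i-x_j=0$ and $x_i-x_j=1$ for $1\le i<j\le n$. Its cone is the arrangement in $\mathbb Q^{n+1}$ consisting of the linear spans of $S\times\{1\}$ for the hyperplanes $S$ of the Shi arrangement, together with $\ker x_{n+1}$; that is, of the hyperplanes $\ker(x_i-x_j)$ and $\ker(x_i-x_j-x_{n+1})$ for $1\le i<j\le n$, and $\ker x_{n+1}$. For an arrangement $\mathcal A$ of linear hyperplanes in a finite-dimensional vector space $V$ over $F$ and $H\in\mathcal A$, let $\mathcal A^H=\{H\cap K\mid K\in\mathcal A,\ K\neq H\}$, an arrangement in $H$. Let $S=S(V^*)$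 and let $D(\mathcal A)$ be the $S$-module of all $F$-derivations $\theta$ of $S$ with $\theta(\alpha)\in\alpha S$ for every linear form $\alpha$ with $\ker\alpha\in\mathcal A$. The arrangement $\mathcal A$ is free with exponents the multiset $e=\exp(\mathcal A)$ if $D(\mathcal A)$ has an $S$-basis of homogeneous derivations whose degrees form $e$, where $\theta$ has degree $d$ if it maps $V^*$ into $S_d$. The inductively free arrangements form the smallest class that contains all empty arrangements and contains $\mathcal A$ whenever, for some $H\in\mathcal A$, both $\mathcal A\setminus\{H\}$ and $\mathcal A^H$ belong to the class and are free with $\exp(\mathcal A^H)\subseteq\exp(\mathcal A\setminus\{H\})$ as multisets. The characteristic polynomial is determined by $\chi(\emptyset,t)=t^{\dim V}$ and $\chi(\mathcal A,t)=\chi(\mathcal A\setminus\{H\},t)-\chi(\mathcal A^H,t)$ for $H\in\mathcal A$ (independently of the choice of $H$). Then the following hold. 1. There is an injective linear map $\phi:(\mathbb Q^n)^*\to(\mathbb Q^{n+1})^*$ such that $\ker\alpha\mapsto\ker\phi(\alpha)$ is a bijection from the hyperplanes of $\mathcal A_{C_n}$ to those of the cone of the Shi arrangement. 2. $\mathcal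 A_{C_n}$ is inductively free, and it is free with exponents $(1,n,\dots,n)$, where $n$ occurs $n-1$ times. 3. The recursion above assigns to $\mathcal A_{C_n}$ exactly one polynomial, namely $\chi(\mathcal A_{C_n},t)=(t-1)(t-n)^{n-1}$. 4. The number of chambers, i.e. of connected components of the complement in $\mathbb R^n$ of the union of the hyperplanes of $\mathcal A_{C_n}(\mathbb R)$, is $(-1)^n\chi(\mathcal A_{C_n},-1)=2(n+1)^{n-1}$. -/

import Mathlib

noncomputable section

/-- A (central) arrangement of hyperplanes: a finite set of hyperplanes, i.e. kernels of nonzero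
linear forms, in the vector space `V`. -/
@[ext]
structure LinArr (F V : Type*) [Field F] [AddCommGroup V] [Module F V] where
  hyps : Set (Submodule F V)
  finite : hyps.Finite
  isHyperplane : ∀ H ∈ hyps, ∃ α : Module.Dual F V, α ≠ 0 ∧ H = LinearMap.ker α

/-- An arrangement of affine hyperplanes `{x | α x = c}`, `α ≠ 0`, in the vector space `V`. -/
structure AffArr (F V : Type*) [Field F] [AddCommGroup V] [Module F V] where
  hyps : Set (Set V)
  finite : hyps.Finite
  isHyperplane : ∀ S ∈ hyps, ∃ (α : Module.Dual F V) (c : F), α ≠ 0 ∧ S = {x | α x = c}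

namespace LinArr

section General

variable {F V : Type*} [Field F] [AddCommGroup V] [Module F V]

/-- The empty arrangement in `V`. -/
def empty (F V : Type*) [Field F] [AddCommGroup V] [Module F V] : LinArr F V where
  hyps := ∅
  finite := Set.finite_empty
  isHyperplane := by simp

/-- The deletion `A ∖ {H}`. -/
def deletion (A : LinArr F V) (H : Submodule F V) : LinArr F V where
  hyps := A.hyps \ {H}
  finite := A.finite.subset Set.sdiff_subset
  isHyperplane := fun K hK => A.isHyperplane K hK.1

/-- The restriction `A^H = {H ∩ K | K ∈ A, H ⊄ K}`, an arrangement in the vector space `H`. -/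
def restriction (A : LinArr F V) (H : Submodule F V) : LinArr F H where
  hyps := {L | ∃ K ∈ A.hyps, ¬ H ≤ K ∧ L = K.comap H.subtype}
  finite := (A.finite.image fun K => K.comap H.subtype).subset (by
    rintro L ⟨K, hK, -, rfl⟩
    exact ⟨K, hK, rfl⟩)
  isHyperplane := by
    rintro L ⟨K, hK, hHK, rfl⟩
    obtain ⟨α, -, rfl⟩ := A.isHyperplane K hK
    refine ⟨α.comp H.subtype, ?_, ?_⟩
    · intro h
      apply hHK
      intro x hx
      exact LinearMap.congr_fun h ⟨x, hx⟩
    · ext x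
      simp

/-- `S = S(V^*)`, the symmetric algebra of the dual space. -/
abbrev Sym (F V : Type*) [Field F] [AddCommGroup V] [Module F V] : Type _ :=
  SymmetricAlgebra F (Module.Dual F V)

/-- A linear form, seen in degree one of the symmetric algebra `S(V^*)`. -/
abbrev linForm (α : Module.Dual F V) : Sym F V := SymmetricAlgebra.ι F (Module.Dual F V) α

/-- The homogeneous component of degree `d` of `S(V^*)`: the span of all products of `d` linear
forms. -/
def homogComponent (F V : Type*) [Field F] [AddCommGroup V] [Module F V] (d : ℕ) :
    Submodule F (Sym F V) :=
  LinearMap.range (SymmetricAlgebra.ι F (Module.Dual F V)) ^ d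

/-- The module `D(A)` of `A`-derivations: all `F`-derivations `θ` of `S` such that
`θ(α_H) ∈ α_H S` for all `H ∈ A`. -/
def derModule (A : LinArr F V) : Submodule (Sym F V) (Derivation F (Sym F V) (Sym F V)) where
  carrier := {θ | ∀ α : Module.Dual F V, LinearMap.ker α ∈ A.hyps → linForm α ∣ θ (linForm α)}
  zero_mem' := by
    intro α _
    simp
  add_mem' := by
    intro θ η hθ hη α hα
    simpa using dvd_add (hθ α hα) (hη α hα)
  smul_mem' := by
    intro s θ hθ α hα
    simpa using (hθ α hα).mul_left s

/-- A derivation of `S(V^*)` is homogeneous of (polynomial) degree `d` if it maps every linear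
form to a homogeneous element of degree `d`; so constant derivations have degree `0` and the Euler
derivation has degree `1`. -/
def IsHomogDer (θ : Derivation F (Sym F V) (Sym F V)) (d : ℕ) : Prop :=
  ∀ α : Module.Dual F V, θ (linForm α) ∈ homogComponent F V d

/-- `A` is free with exponents the multiset `e`: the `S`-module `D(A)` has a basis of homogeneous
derivations whose degrees form the multiset `e`. -/
def FreeWithExponents (A : LinArr F V) (e : Multiset ℕ) : Prop :=
  ∃ (k : ℕ) (d : Fin k → ℕ) (b : Module.Basis (Fin k) (Sym F V) A.derModule),
    (∀ i, IsHomogDer (b i : Derivation F (Sym F V) (Sym F V)) (d i)) ∧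
      Finset.univ.val.map d = e

end General

universe u v

/-- The class of inductively free arrangements: the smallest class that contains the empty
arrangements and contains `A` whenever there is `H ∈ A` such that the deletion `A' = A ∖ {H}` and
the restriction `A'' = A^H` belong to it and `exp(A'') ⊆ exp(A')` (as multisets). -/
inductive InductivelyFree {F : Type u} [Field F] :
    ∀ {V : Type v} [AddCommGroup V] [Module F V], LinArr F V → Prop
  | empty (V : Type v) [AddCommGroup V] [Module F V] [FiniteDimensional F V] :
      InductivelyFree (LinArr.empty F V)
  | add {V : Type v} [AddCommGroup V] [Module F V] (A : LinArr F V) (H : Submodule F V)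
      (hH : H ∈ A.hyps) (e' e'' : Multiset ℕ)
      (hdel : InductivelyFree (A.deletion H)) (hres : InductivelyFree (A.restriction H))
      (hexp' : (A.deletion H).FreeWithExponents e')
      (hexp'' : (A.restriction H).FreeWithExponents e'') (hle : e'' ≤ e') :
      InductivelyFree A

/-- `IsCharPoly A p`: the polynomial `p` is obtained for the arrangement `A` by the recursion
`χ(∅) = t ^ dim V` and `χ(A) = χ(A ∖ {H}) - χ(A^H)` for some `H ∈ A`. -/
inductive IsCharPoly {F : Type u} [Field F] :
    ∀ {V : Type v} [AddCommGroup V] [Module F V], LinArr F V → Polynomial ℤ → Prop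
  | empty (V : Type v) [AddCommGroup V] [Module F V] [FiniteDimensional F V] :
      IsCharPoly (LinArr.empty F V) (Polynomial.X ^ Module.finrank F V)
  | step {V : Type v} [AddCommGroup V] [Module F V] (A : LinArr F V) (H : Submodule F V)
      (hH : H ∈ A.hyps) (p' p'' : Polynomial ℤ)
      (hdel : IsCharPoly (A.deletion H) p') (hres : IsCharPoly (A.restriction H) p'') :
      IsCharPoly A (p' - p'')

/-- The chambers of a real arrangement: the connected components of the complement of the union
of its hyperplanes. -/
abbrev Chambers {V : Type*} [AddCommGroup V] [Module ℝ V] [TopologicalSpace V]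
    (A : LinArr ℝ V) : Type _ :=
  ConnectedComponents {x : V // ∀ H ∈ A.hyps, x ∉ H}

end LinArr

/-- The linear form `∑_{i ∈ I} x_i` on `F^n`. -/
def coordSum (F : Type*) [Field F] {n : ℕ} (I : Finset (Fin n)) : Module.Dual F (Fin n → F) :=
  ∑ i ∈ I, LinearMap.proj i

theorem coordSum_ne_zero (F : Type*) [Field F] {n : ℕ} {I : Finset (Fin n)} (hI : I.Nonempty) :
    coordSum F I ≠ 0 := by
  obtain ⟨j, hj⟩ := hI
  intro h
  have := LinearMap.congr_fun h (Pi.single j 1)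
  simp [coordSum, LinearMap.sum_apply, Pi.single_apply, hj] at this

/-- The connected subgraph arrangement `A_G(F)` of a graph `G` on `n` vertices: all hyperplanes
`H_I = ker ∑_{i ∈ I} x_i` in `F^n` for nonempty vertex sets `I` with connected induced subgraph
`G[I]`. -/
def connSubgraphArr (F : Type*) [Field F] {n : ℕ} (G : SimpleGraph (Fin n)) :
    LinArr F (Fin n → F) where
  hyps := {H | ∃ I : Finset (Fin n), I.Nonempty ∧ (G.induce (I : Set (Fin n))).Connected ∧
    H = LinearMap.ker (coordSum F I)}
  finite := (Set.finite_range fun I : Finset (Fin n) => LinearMap.ker (coordSum F I)).subset (by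
    rintro H ⟨I, -, -, rfl⟩
    exact ⟨I, rfl⟩)
  isHyperplane := by
    rintro H ⟨I, hI, -, rfl⟩
    exact ⟨coordSum F I, coordSum_ne_zero F hI, rfl⟩

/-- The hyperplane of `F^{n+1}` spanned by `S × {1}`, for an affine hyperplane `S` of `F^n`. -/
def coneHyp {F : Type*} [Field F] {n : ℕ} (S : Set (Fin n → F)) : Submodule F (Fin (n + 1) → F) :=
  Submodule.span F {y | ∃ x ∈ S, y = Fin.snoc x 1}

/-- The linear form `α - c x_{n+1}` on `F^{n+1}`, for a linear form `α` on `F^n`. -/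
def homogForm {F : Type*} [Field F] {n : ℕ} (α : Module.Dual F (Fin n → F)) (c : F) :
    Module.Dual F (Fin (n + 1) → F) :=
  α.comp (LinearMap.funLeft F F Fin.castSucc) - c • LinearMap.proj (Fin.last n)

theorem homogForm_apply {F : Type*} [Field F] {n : ℕ} (α : Module.Dual F (Fin n → F)) (c : F)
    (y : Fin (n + 1) → F) :
    homogForm α c y = α (fun i => y i.castSucc) - c * y (Fin.last n) := rfl

theorem homogForm_ne_zero {F : Type*} [Field F] {n : ℕ} {α : Module.Dual F (Fin n → F)}
    (hα : α ≠ 0) (c : F) : homogForm α c ≠ 0 := by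
  intro h
  apply hα
  ext1 i
  ext
  have := LinearMap.congr_fun h (Fin.snoc (Pi.single i 1) 0)
  rw [homogForm_apply] at this
  simpa using this

/-- The cone over `{α = c}` is the kernel of the homogenized form `α - c x_{n+1}`. -/
theorem coneHyp_eq_ker {F : Type*} [Field F] {n : ℕ} {α : Module.Dual F (Fin n → F)}
    (hα : α ≠ 0) (c : F) : coneHyp {x | α x = c} = LinearMap.ker (homogForm α c) := by
  have key : ∀ x : Fin n → F, α x = c →
      (Fin.snoc x 1 : Fin (n + 1) → F) ∈ coneHyp {x | α x = c} :=
    fun x hx => Submodule.subset_span ⟨x, hx, rfl⟩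
  apply le_antisymm
  · refine Submodule.span_le.2 ?_
    rintro _ ⟨x, hx, rfl⟩
    have hx' : α x = c := hx
    simp [homogForm_apply, hx']
  · intro y hy
    have hy' : α (fun i => y i.castSucc) = c * y (Fin.last n) := by
      have : homogForm α c y = 0 := hy
      rwa [homogForm_apply, sub_eq_zero] at this
    obtain ⟨x₁, hx₁⟩ := LinearMap.surjective hα c
    set z : Fin n → F := fun i => y i.castSucc with hz
    have h1 : α (x₁ + (z - y (Fin.last n) • x₁)) = c := by
      simp [hx₁, hy', mul_comm]
    have h2 : y = Fin.snoc (x₁ + (z - y (Fin.last n) • x₁)) 1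
        + (y (Fin.last n) - 1) • (Fin.snoc x₁ 1 : Fin (n + 1) → F) := by
      funext i
      refine Fin.lastCases ?_ (fun j => ?_) i
      · simp
      · simp [hz]
        ring
    rw [h2]
    exact add_mem (key _ h1) (Submodule.smul_mem _ _ (key _ hx₁))

/-- The cone `cA` of an affine arrangement `A` in `F^n`: the arrangement in `F^{n+1}` that consists
of the cones over the hyperplanes of `A` (placed at height `x_{n+1} = 1`) and of `ker x_{n+1}`. -/
def cone {F : Type*} [Field F] {n : ℕ} (A : AffArr F (Fin n → F)) :
    LinArr F (Fin (n + 1) → F) where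
  hyps := insert (LinearMap.ker (LinearMap.proj (Fin.last n) : Module.Dual F (Fin (n + 1) → F)))
    (coneHyp '' A.hyps)
  finite := (A.finite.image _).insert _
  isHyperplane := by
    rintro H (rfl | ⟨S, hS, rfl⟩)
    · refine ⟨_, ?_, rfl⟩
      intro h
      have := LinearMap.congr_fun h (Pi.single (Fin.last n) 1)
      simp at this
    · obtain ⟨α, c, hα, rfl⟩ := A.isHyperplane S hS
      exact ⟨homogForm α c, homogForm_ne_zero hα c, coneHyp_eq_ker hα c⟩

/-- The linear form `x_i - x_j` on `F^n`. -/
def coordDiff (F : Type*) [Field F] {n : ℕ} (i j : Fin n) : Module.Dual F (Fin n → F) :=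
  (LinearMap.proj i : Module.Dual F (Fin n → F)) - LinearMap.proj j

theorem coordDiff_ne_zero (F : Type*) [Field F] {n : ℕ} {i j : Fin n} (hij : i < j) :
    coordDiff F i j ≠ 0 := by
  intro h
  have := LinearMap.congr_fun h (Pi.single i 1)
  simp [coordDiff, hij.ne'] at this

/-- The Shi arrangement of type `A`: the affine hyperplanes `x_i - x_j = 0` and `x_i - x_j = 1`
for `i < j` in `ℚ^n`. -/
def shiArr (n : ℕ) : AffArr ℚ (Fin n → ℚ) where
  hyps := {S | ∃ i j : Fin n, i < j ∧
    (S = {x | coordDiff ℚ i j x = 0} ∨ S = {x | coordDiff ℚ i j x = 1})}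
  finite := ((Set.finite_range fun p : Fin n × Fin n => {x | coordDiff ℚ p.1 p.2 x = 0}).union
    (Set.finite_range fun p : Fin n × Fin n => {x | coordDiff ℚ p.1 p.2 x = 1})).subset (by
      rintro S ⟨i, j, -, rfl | rfl⟩
      · exact Or.inl ⟨(i, j), rfl⟩
      · exact Or.inr ⟨(i, j), rfl⟩)
  isHyperplane := by
    rintro S ⟨i, j, hij, rfl | rfl⟩
    · exact ⟨_, 0, coordDiff_ne_zero ℚ hij, rfl⟩
    · exact ⟨_, 1, coordDiff_ne_zero ℚ hij, rfl⟩

/-- The cone of the Shi arrangement consists of the hyperplanes `ker (x_i - x_j)` and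
`ker (x_i - x_j - x_{n+1})` for `i < j ≤ n`, and `ker x_{n+1}`. -/
theorem mem_cone_shiArr (n : ℕ) (H : Submodule ℚ (Fin (n + 1) → ℚ)) :
    H ∈ (cone (shiArr n)).hyps ↔
      H = LinearMap.ker (LinearMap.proj (Fin.last n) : Module.Dual ℚ (Fin (n + 1) → ℚ)) ∨
      ∃ i j : Fin n, i < j ∧
        (H = LinearMap.ker (coordDiff ℚ i.castSucc j.castSucc) ∨
         H = LinearMap.ker (coordDiff ℚ i.castSucc j.castSucc - LinearMap.proj (Fin.last n))) := by
  have h0 : ∀ i j : Fin n, homogForm (coordDiff ℚ i j) 0 = coordDiff ℚ i.castSucc j.castSucc := by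
    intro i j
    ext1 k
    ext
    simp [homogForm_apply, coordDiff]
  have h1 : ∀ i j : Fin n, homogForm (coordDiff ℚ i j) 1 =
      coordDiff ℚ i.castSucc j.castSucc - LinearMap.proj (Fin.last n) := by
    intro i j
    ext1 k
    ext
    simp [homogForm_apply, coordDiff]
  constructor
  · rintro (rfl | ⟨S, ⟨i, j, hij, rfl | rfl⟩, rfl⟩)
    · exact Or.inl rfl
    · refine Or.inr ⟨i, j, hij, Or.inl ?_⟩
      rw [coneHyp_eq_ker (coordDiff_ne_zero ℚ hij), h0]
    · refine Or.inr ⟨i, j, hij, Or.inr ?_⟩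
      rw [coneHyp_eq_ker (coordDiff_ne_zero ℚ hij), h1]
  · rintro (rfl | ⟨i, j, hij, rfl | rfl⟩)
    · exact Or.inl rfl
    · exact Or.inr ⟨_, ⟨i, j, hij, Or.inl rfl⟩, by
        rw [coneHyp_eq_ker (coordDiff_ne_zero ℚ hij), h0]⟩
    · exact Or.inr ⟨_, ⟨i, j, hij, Or.inr rfl⟩, by
        rw [coneHyp_eq_ker (coordDiff_ne_zero ℚ hij), h1]⟩

/-- The action on subspaces of a linear map `φ : V^* → W^*` between dual spaces: the annihilator of
`H` is mapped by `φ`, and the common kernel of the resulting forms is taken. For a hyperplane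
`ker α` the result is `ker (φ α)`. -/
def mapHyp {F V W : Type*} [Field F] [AddCommGroup V] [Module F V] [AddCommGroup W] [Module F W]
    (φ : Module.Dual F V →ₗ[F] Module.Dual F W) (H : Submodule F V) : Submodule F W :=
  (H.dualAnnihilator.map φ).dualCoannihilator

theorem mapHyp_ker {F V W : Type*} [Field F] [AddCommGroup V] [Module F V] [AddCommGroup W]
    [Module F W] (φ : Module.Dual F V →ₗ[F] Module.Dual F W) (α : Module.Dual F V) :
    mapHyp φ (LinearMap.ker α) = LinearMap.ker (φ α) := by
  ext w
  simp only [mapHyp, Submodule.mem_dualCoannihilator, LinearMap.mem_ker]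
  constructor
  · intro h
    exact h _ (Submodule.mem_map_of_mem ((Submodule.mem_dualAnnihilator α).2 fun x hx => hx))
  · rintro h _ ⟨β, hβ, rfl⟩
    have hβ' : ∀ x, α x = 0 → β x = 0 := fun x hx => (Submodule.mem_dualAnnihilator β).1 hβ x hx
    obtain ⟨c, rfl⟩ : ∃ c : F, β = c • α := by
      by_cases hα : α = 0
      · refine ⟨0, ?_⟩
        ext x
        simp [hβ' x (by simp [hα])]
      · obtain ⟨y, hy⟩ := LinearMap.surjective hα 1
        refine ⟨β y, ?_⟩
        ext x
        have := hβ' (x - α x • y) (by simp [hy])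
        rw [map_sub, map_smul, sub_eq_zero] at this
        simpa [mul_comm] using this
    simp [h]

end

/-! Let `z` be the sum of all coordinates and `y_i` the sum of the coordinates before `i`. The
connected vertex sets of a cycle are its arcs, and their forms are, up to sign, `z`, `y_j - y_i` and
`y_j - y_i - z` for `i < j`. These are the forms of the cone of the Shi arrangement after a change
of variables dual to a surjection `F^{n+1} → F^n`.

Freeness, inductive freeness and the characteristic polynomial are proved together (`IsGood`) for a
larger family, in which hyperplanes `y_i = c z` with `0 ≤ c < u i` ("pins") are added to the Shi
hyperplanes (`shiHyps`). The pin counts are `N + 1` on an upper set of vertices and `N` below.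
Removing the top pin `y_m = N z` of the lowest vertex `m` with `N + 1` pins stays in the family.
Restricting to that pin eliminates `m` and raises all other counts by one (`shiHyps_erase`).
Measuring from the smallest vertex turns a Shi arrangement on `r + 1` vertices into a pinned one on
`r` vertices with `N = 2`; conversely, adding pins at `0` from the top vertex downwards leads from
the Shi arrangement to `N = 1`. This closes an induction (`pinnedGood`).

The engine is the addition theorem: if `A'` and `A''` are free with exponents `b, e` and `e`, then
`A` is free with exponents `b + 1, e`. Its core is a polynomial `B` on `H` of degree `|A'| - |A''|`
that divides the restriction of `θ(α)` for all `θ ∈ D(A')`; counting basis elements of degree at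
most `b` shows that one of degree `b` attains `B` up to a scalar.

Whitney's alternating sum over subarrangements satisfies the deletion-restriction recursion, so the
characteristic polynomial is unique. Sign patterns of the complement satisfy the additive form of
the recursion, which gives the number of chambers. -/

noncomputable section

namespace LinArr

/-! ### The symmetric algebra of the dual space: grading, derivations, restriction to a hyperplane.
-/

section SymAlg

variable {F V : Type*} [Field F] [AddCommGroup V] [Module F V]

/-! ### The grading of `S(V^*)` -/

/-- The algebra homomorphism `S → S[t]` that multiplies each linear form by `t`. -/
def gradingHom (F V : Type*) [Field F] [AddCommGroup V] [Module F V] :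
    Sym F V →ₐ[F] Polynomial (Sym F V) :=
  SymmetricAlgebra.lift
    ((Polynomial.monomial (R := Sym F V) 1).restrictScalars F ∘ₗ
      SymmetricAlgebra.ι F (Module.Dual F V))

theorem gradingHom_linForm (α : Module.Dual F V) :
    gradingHom F V (linForm α) = Polynomial.monomial 1 (linForm α) := by
  simp [gradingHom]

/-- The homogeneous component of degree `d` of an element of `S(V^*)`. -/
def component (d : ℕ) : Sym F V →ₗ[F] Sym F V :=
  (Polynomial.lcoeff (Sym F V) d).restrictScalars F ∘ₗ (gradingHom F V).toLinearMap

theorem component_apply (d : ℕ) (f : Sym F V) :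
    component d f = (gradingHom F V f).coeff d := rfl

theorem linForm_mem_homogComponent (α : Module.Dual F V) :
    linForm α ∈ homogComponent F V 1 := by
  rw [homogComponent, pow_one]
  exact ⟨α, rfl⟩

theorem mul_mem_homogComponent {a b : ℕ} {f g : Sym F V} (hf : f ∈ homogComponent F V a)
    (hg : g ∈ homogComponent F V b) : f * g ∈ homogComponent F V (a + b) := by
  rw [homogComponent, pow_add]
  exact Submodule.mul_mem_mul hf hg

theorem algebraMap_mem_homogComponent (c : F) :
    algebraMap F (Sym F V) c ∈ homogComponent F V 0 := by
  rw [homogComponent, pow_zero]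
  exact Submodule.algebraMap_mem c

theorem gradingHom_of_mem {d : ℕ} {f : Sym F V} (hf : f ∈ homogComponent F V d) :
    gradingHom F V f = Polynomial.monomial d f := by
  induction hf using Submodule.pow_induction_on_left' with
  | algebraMap r =>
    rw [AlgHom.commutes]
    rfl
  | add x y i hx hy h1 h2 => rw [map_add, h1, h2, map_add]
  | mem_mul m hm i x hx h =>
    obtain ⟨α, rfl⟩ := hm
    rw [map_mul, h]
    erw [gradingHom_linForm]
    rw [Polynomial.monomial_mul_monomial, add_comm]

theorem component_of_mem {d : ℕ} {f : Sym F V} (hf : f ∈ homogComponent F V d) :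
    component d f = f := by
  rw [component_apply, gradingHom_of_mem hf, Polynomial.coeff_monomial_same]

theorem component_mul_of_mem {k : ℕ} {g : Sym F V} (hg : g ∈ homogComponent F V k) (d : ℕ)
    (f : Sym F V) :
    component d (f * g) = if k ≤ d then component (d - k) f * g else 0 := by
  rw [component_apply, map_mul, gradingHom_of_mem hg, ← Polynomial.C_mul_X_pow_eq_monomial,
    ← mul_assoc, Polynomial.coeff_mul_X_pow']
  simp [component_apply]

theorem component_mem (d : ℕ) (f : Sym F V) : component d f ∈ homogComponent F V d := by
  induction f using SymmetricAlgebra.induction generalizing d with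
  | algebraMap r =>
    rw [component_apply, AlgHom.commutes, Polynomial.algebraMap_apply, Polynomial.coeff_C]
    split_ifs with h
    · subst h
      exact algebraMap_mem_homogComponent r
    · exact zero_mem _
  | ι x =>
    rw [component_apply]
    erw [gradingHom_linForm]
    rw [Polynomial.coeff_monomial]
    split_ifs with h
    · subst h
      exact linForm_mem_homogComponent x
    · exact zero_mem _
  | mul a b ha hb =>
    rw [component_apply, map_mul, Polynomial.coeff_mul]
    refine Submodule.sum_mem _ fun p hp => ?_
    rw [← Finset.HasAntidiagonal.mem_antidiagonal.1 hp]
    exact mul_mem_homogComponent (ha _) (hb _)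
  | add a b ha hb =>
    rw [map_add]
    exact add_mem (ha _) (hb _)

theorem prod_mem_homogComponent {ι : Type*} (s : Finset ι) (f : ι → Sym F V) (d : ι → ℕ)
    (h : ∀ i ∈ s, f i ∈ homogComponent F V (d i)) :
    ∏ i ∈ s, f i ∈ homogComponent F V (∑ i ∈ s, d i) := by
  classical
  induction s using Finset.induction_on with
  | empty => simpa using algebraMap_mem_homogComponent (V := V) (1 : F)
  | insert a s ha ih =>
    rw [Finset.prod_insert ha, Finset.sum_insert ha]
    exact mul_mem_homogComponent (h a (by simp)) (ih fun i hi => h i (by simp [hi]))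

theorem pow_mem_homogComponent {a : ℕ} {f : Sym F V} (hf : f ∈ homogComponent F V a) (n : ℕ) :
    f ^ n ∈ homogComponent F V (n * a) := by
  simpa using prod_mem_homogComponent (Finset.range n) (fun _ => f) (fun _ => a) fun _ _ => hf

/-- A homogeneous element divisible by a nonzero homogeneous element has a homogeneous quotient,
which is zero if the degree is too small. -/
theorem exists_homog_quotient {a d : ℕ} {B f : Sym F V} (hB : B ∈ homogComponent F V a)
    (hf : f ∈ homogComponent F V d) (h : B ∣ f) :
    (a ≤ d → ∃ g ∈ homogComponent F V (d - a), f = g * B) ∧ (d < a → f = 0) := by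
  obtain ⟨q, rfl⟩ := h
  have h1 := component_mul_of_mem hB d q
  rw [mul_comm q, component_of_mem hf] at h1
  refine ⟨fun had => ⟨component (d - a) q, component_mem _ _, ?_⟩, fun hda => ?_⟩
  · rwa [if_pos had] at h1
  · rwa [if_neg hda.not_ge] at h1

/-! ### Derivations of `S(V^*)` -/

theorem derivation_ext {θ η : Derivation F (Sym F V) (Sym F V)}
    (h : ∀ α : Module.Dual F V, θ (linForm α) = η (linForm α)) : θ = η := by
  ext f
  induction f using SymmetricAlgebra.induction with
  | algebraMap r => simp
  | ι x => exact h x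
  | mul a b ha hb => rw [Derivation.leibniz, Derivation.leibniz, ha, hb]
  | add a b ha hb => rw [map_add, map_add, ha, hb]

/-- The algebra homomorphism `S → S[ε]` attached to a linear map `V^* → S`. -/
def mkDerHom (f : Module.Dual F V →ₗ[F] Sym F V) :
    Sym F V →ₐ[F] TrivSqZeroExt (Sym F V) (Sym F V) :=
  SymmetricAlgebra.lift
    ((TrivSqZeroExt.inlAlgHom F (Sym F V) (Sym F V)).toLinearMap ∘ₗ
        SymmetricAlgebra.ι F (Module.Dual F V) +
      (TrivSqZeroExt.inrHom (Sym F V) (Sym F V)).restrictScalars F ∘ₗ f)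

theorem mkDerHom_linForm (f : Module.Dual F V →ₗ[F] Sym F V) (α : Module.Dual F V) :
    mkDerHom f (linForm α) = TrivSqZeroExt.inl (linForm α) + TrivSqZeroExt.inr (f α) := by
  simp [mkDerHom]

theorem fst_mkDerHom (f : Module.Dual F V →ₗ[F] Sym F V) (x : Sym F V) :
    (mkDerHom f x).fst = x := by
  have : (TrivSqZeroExt.fstHom F (Sym F V) (Sym F V)).comp (mkDerHom f) = AlgHom.id F _ := by
    apply SymmetricAlgebra.algHom_ext
    ext α
    simpa using congrArg TrivSqZeroExt.fst (mkDerHom_linForm f α)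
  exact DFunLike.congr_fun this x

/-- The derivation of `S(V^*)` with prescribed values on linear forms. -/
def mkDer (f : Module.Dual F V →ₗ[F] Sym F V) : Derivation F (Sym F V) (Sym F V) :=
  Derivation.mk' ((TrivSqZeroExt.sndHom (Sym F V) (Sym F V)).restrictScalars F ∘ₗ
      (mkDerHom f).toLinearMap) (by
    intro a b
    simp [TrivSqZeroExt.snd_mul, fst_mkDerHom, mul_comm])

theorem mkDer_linForm (f : Module.Dual F V →ₗ[F] Sym F V) (α : Module.Dual F V) :
    mkDer f (linForm α) = f α := by
  change (mkDerHom f (linForm α)).snd = f α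
  rw [mkDerHom_linForm]
  simp

/-! ### Restriction of polynomial functions to a subspace -/

/-- The restriction of linear forms to a subspace. -/
abbrev resDual (H : Submodule F V) : Module.Dual F V →ₗ[F] Module.Dual F H :=
  H.subtype.dualMap

theorem resDual_surjective (H : Submodule F V) : Function.Surjective (resDual H) :=
  LinearMap.dualMap_surjective_of_injective H.injective_subtype

/-- The restriction homomorphism `S(V^*) → S(H^*)`. -/
def res (H : Submodule F V) : Sym F V →ₐ[F] Sym F H :=
  SymmetricAlgebra.lift (SymmetricAlgebra.ι F (Module.Dual F H) ∘ₗ resDual H)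

@[simp]
theorem res_linForm (H : Submodule F V) (α : Module.Dual F V) :
    res H (linForm α) = linForm (resDual H α) := by
  simp [res]

theorem res_mem_homogComponent (H : Submodule F V) {d : ℕ} {f : Sym F V}
    (hf : f ∈ homogComponent F V d) : res H f ∈ homogComponent F H d := by
  induction hf using Submodule.pow_induction_on_left' with
  | algebraMap r =>
    rw [AlgHom.commutes]
    exact algebraMap_mem_homogComponent r
  | add x y i hx hy h1 h2 => rw [map_add]; exact add_mem h1 h2
  | mem_mul m hm i x hx h =>
    obtain ⟨α, rfl⟩ := hm
    rw [map_mul, Nat.succ_eq_add_one, add_comm]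
    refine mul_mem_homogComponent ?_ h
    erw [res_linForm]
    exact linForm_mem_homogComponent _

theorem exists_res_eq_of_mem (H : Submodule F V) {d : ℕ} {g : Sym F H}
    (hg : g ∈ homogComponent F H d) : ∃ f ∈ homogComponent F V d, res H f = g := by
  induction hg using Submodule.pow_induction_on_left' with
  | algebraMap r =>
    exact ⟨algebraMap F _ r, algebraMap_mem_homogComponent r, AlgHom.commutes _ _⟩
  | add x y i hx hy h1 h2 =>
    obtain ⟨a, ha, rfl⟩ := h1
    obtain ⟨b, hb, rfl⟩ := h2
    exact ⟨a + b, add_mem ha hb, map_add _ _ _⟩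
  | mem_mul m hm i x hx h =>
    obtain ⟨α, rfl⟩ := hm
    obtain ⟨f, hf, rfl⟩ := h
    obtain ⟨β, rfl⟩ := resDual_surjective H α
    refine ⟨linForm β * f, ?_, ?_⟩
    · rw [Nat.succ_eq_add_one, add_comm]
      exact mul_mem_homogComponent (linForm_mem_homogComponent β) hf
    · rw [map_mul, res_linForm]

theorem res_surjective (H : Submodule F V) : Function.Surjective (res H) := by
  intro g
  induction g using SymmetricAlgebra.induction with
  | algebraMap r => exact ⟨algebraMap F _ r, AlgHom.commutes _ _⟩
  | ι x =>
    obtain ⟨β, rfl⟩ := resDual_surjective H x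
    exact ⟨linForm β, res_linForm H β⟩
  | mul a b ha hb =>
    obtain ⟨a, rfl⟩ := ha
    obtain ⟨b, rfl⟩ := hb
    exact ⟨a * b, map_mul _ _ _⟩
  | add a b ha hb =>
    obtain ⟨a, rfl⟩ := ha
    obtain ⟨b, rfl⟩ := hb
    exact ⟨a + b, map_add _ _ _⟩

/-- A form that vanishes on the kernel of `α` is a multiple of `α`. -/
theorem exists_smul_of_ker_le {α β : Module.Dual F V}
    (h : LinearMap.ker α ≤ LinearMap.ker β) : ∃ c : F, β = c • α := by
  by_cases hα : α = 0
  · refine ⟨0, ?_⟩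
    ext x
    have : x ∈ LinearMap.ker β := h (by simp [hα])
    simpa using this
  · obtain ⟨y, hy⟩ := LinearMap.surjective hα 1
    refine ⟨β y, ?_⟩
    ext x
    have : x - α x • y ∈ LinearMap.ker β := h (by simp [hy])
    rw [LinearMap.mem_ker, map_sub, map_smul, sub_eq_zero] at this
    simpa [mul_comm] using this

theorem resDual_ker_eq_zero_iff (α β : Module.Dual F V) :
    resDual (LinearMap.ker α) β = 0 ↔ LinearMap.ker α ≤ LinearMap.ker β := by
  constructor
  · intro h x hx
    exact LinearMap.congr_fun h ⟨x, hx⟩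
  · intro h
    ext x
    exact h x.2

/-- The kernel of the restriction to `ker α` is the ideal generated by `α`. -/
theorem res_eq_zero_iff (α : Module.Dual F V) (f : Sym F V) :
    res (LinearMap.ker α) f = 0 ↔ linForm α ∣ f := by
  set H := LinearMap.ker α with hH
  constructor
  · intro hf
    obtain ⟨s, hs⟩ := (resDual H).exists_rightInverse_of_surjective
      (LinearMap.range_eq_top.2 (resDual_surjective H))
    let I : Ideal (Sym F V) := Ideal.span {linForm α}
    -- A linear section `s` of restriction induces `S(H^*) → S/(α)`. Its composite with `res H` is
    -- the quotient map, because `s (resDual H β)` and `β` differ by a multiple of `α`; so `res H f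
    -- = 0` forces `f ∈ (α)`.
    let ψ : Sym F H →ₐ[F] (Sym F V ⧸ I) := SymmetricAlgebra.lift
      ((Ideal.Quotient.mkₐ F I).toLinearMap ∘ₗ SymmetricAlgebra.ι F (Module.Dual F V) ∘ₗ s)
    have key : ψ.comp (res H) = Ideal.Quotient.mkₐ F I := by
      apply SymmetricAlgebra.algHom_ext
      ext β
      have h1 : ψ (res H (linForm β)) =
          Ideal.Quotient.mk I (linForm (s (resDual H β))) := by
        rw [res_linForm]
        simp [ψ]
      change ψ (res H (linForm β)) = Ideal.Quotient.mk I (linForm β)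
      rw [h1, Ideal.Quotient.eq, Ideal.mem_span_singleton, ← map_sub]
      have h2 : resDual H (s (resDual H β) - β) = 0 := by
        rw [map_sub, sub_eq_zero]
        exact LinearMap.congr_fun hs _
      obtain ⟨c, hc⟩ := exists_smul_of_ker_le ((resDual_ker_eq_zero_iff α _).1 h2)
      rw [hc, map_smul]
      exact ⟨algebraMap F _ c, by rw [Algebra.smul_def, mul_comm]⟩
    have h3 := DFunLike.congr_fun key f
    rw [AlgHom.comp_apply, hf, map_zero] at h3
    exact Ideal.mem_span_singleton.1 (Ideal.Quotient.eq_zero_iff_mem.1 h3.symm)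
  · rintro ⟨g, rfl⟩
    rw [map_mul, res_linForm, (resDual_ker_eq_zero_iff α α).2 le_rfl, linForm, map_zero, zero_mul]

theorem res_eq_zero_iff_of_eq {H : Submodule F V} {α : Module.Dual F V}
    (hH : H = LinearMap.ker α) (f : Sym F V) : res H f = 0 ↔ linForm α ∣ f := by
  subst hH
  exact res_eq_zero_iff α f

theorem exists_smul_of_resDual_eq_zero {H : Submodule F V} {α β : Module.Dual F V}
    (hH : H = LinearMap.ker α) (h : resDual H β = 0) : ∃ c : F, β = c • α := by
  subst hH
  exact exists_smul_of_ker_le ((resDual_ker_eq_zero_iff α β).1 h)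

/-- A directional derivative detects a nonzero form: if `α y = 1`, the derivation with `β ↦ β y`
sends `α` to `1`. -/
theorem linForm_injective : Function.Injective (linForm : Module.Dual F V → Sym F V) := by
  rw [injective_iff_map_eq_zero (SymmetricAlgebra.ι F (Module.Dual F V))]
  intro α hα
  by_contra h
  obtain ⟨y, hy⟩ := LinearMap.surjective h 1
  have := mkDer_linForm (Algebra.linearMap F (Sym F V) ∘ₗ Module.Dual.eval F V y) α
  rw [show linForm α = 0 from hα, map_zero] at this
  simp [hy] at this

theorem linForm_ne_zero {α : Module.Dual F V} (hα : α ≠ 0) : linForm α ≠ 0 := by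
  intro h
  exact hα (linForm_injective (by rw [h, linForm, map_zero]))

theorem linForm_dvd_linForm_iff (α β : Module.Dual F V) :
    linForm α ∣ linForm β ↔ LinearMap.ker α ≤ LinearMap.ker β := by
  rw [← res_eq_zero_iff, res_linForm, ← resDual_ker_eq_zero_iff]
  exact ⟨fun h => linForm_injective (by rw [h, linForm, map_zero]), fun h => by
    rw [h, linForm, map_zero]⟩

/-- The multiples of `α` are the kernel of a homomorphism to `S((ker α)^*)`, which is a domain. -/
theorem linForm_prime {α : Module.Dual F V} (hα : α ≠ 0) : Prime (linForm α) := by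
  refine ⟨linForm_ne_zero hα, ?_, ?_⟩
  · intro h
    have := (res_eq_zero_iff α 1).2 h.dvd
    simp at this
  · intro a b h
    simp only [← res_eq_zero_iff, map_mul, mul_eq_zero] at h ⊢
    exact h

end SymAlg

/-! ### Derivations under deletion and restriction. -/

section Freeness

variable {F V : Type*} [Field F] [AddCommGroup V] [Module F V]

theorem sum_derivation_apply {ι : Type*} (s : Finset ι) (f : ι → Sym F V)
    (θ : ι → Derivation F (Sym F V) (Sym F V)) (x : Sym F V) :
    (∑ i ∈ s, f i • θ i) x = ∑ i ∈ s, f i * θ i x := by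
  classical
  induction s using Finset.induction_on with
  | empty => simp
  | insert a s ha ih =>
    rw [Finset.sum_insert ha, Finset.sum_insert ha, Derivation.add_apply, ih,
      Derivation.smul_apply, smul_eq_mul]

theorem coe_sum_smul {A : LinArr F V} {ι : Type*} (s : Finset ι) (f : ι → Sym F V)
    (b : ι → A.derModule) :
    ((∑ i ∈ s, f i • b i : A.derModule) : Derivation F (Sym F V) (Sym F V)) =
      ∑ i ∈ s, f i • (b i : Derivation F (Sym F V) (Sym F V)) := by
  push_cast
  rfl

/-- The coefficients of a homogeneous derivation with respect to a homogeneous basis. -/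
theorem repr_of_isHomogDer {A : LinArr F V} {k : ℕ} {e : Fin k → ℕ}
    (b : Module.Basis (Fin k) (Sym F V) A.derModule)
    (hb : ∀ i, IsHomogDer (b i : Derivation F (Sym F V) (Sym F V)) (e i)) {d : ℕ}
    (θ : A.derModule) (hθ : IsHomogDer (θ : Derivation F (Sym F V) (Sym F V)) d) (i : Fin k)
    (hi : d < e i) : b.repr θ i = 0 := by
  set f : Fin k → Sym F V := fun i => b.repr θ i with hf
  -- Taking the degree `d` part of `θ = ∑ f i • b i` on every form replaces `f i` by its component
  -- of degree `d - e i`, and by `0` if `e i > d`. Uniqueness of coefficients then gives `f = f'`.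
  set f' : Fin k → Sym F V := fun i => if e i ≤ d then component (d - e i) (f i) else 0 with hf'
  have hsum : ∑ i, f i • b i = θ := b.sum_repr θ
  have h : ∑ i, f' i • b i = θ := by
    apply Subtype.ext
    rw [coe_sum_smul]
    apply derivation_ext
    intro α
    have h1 : (θ : Derivation F (Sym F V) (Sym F V)) (linForm α) =
        ∑ i, f i * (b i : Derivation F (Sym F V) (Sym F V)) (linForm α) := by
      rw [← sum_derivation_apply, ← coe_sum_smul, hsum]
    rw [sum_derivation_apply, ← component_of_mem (hθ α), h1, map_sum]
    refine Finset.sum_congr rfl fun i _ => ?_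
    rw [component_mul_of_mem (hb i α)]
    simp only [hf']
    split_ifs <;> simp
  have h2 : b.repr θ i = f' i := by
    rw [← h, b.repr_sum_self]
  rw [h2, hf']
  simp [hi.not_ge]

theorem ker_eq_of_ker_le {α β : Module.Dual F V} (hβ : β ≠ 0)
    (h : LinearMap.ker α ≤ LinearMap.ker β) : LinearMap.ker α = LinearMap.ker β := by
  obtain ⟨c, rfl⟩ := exists_smul_of_ker_le h
  have hc : c ≠ 0 := by
    rintro rfl
    simp at hβ
  rw [LinearMap.ker_smul _ _ hc]

theorem ne_zero_of_ker_mem {A : LinArr F V} {α : Module.Dual F V}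
    (h : LinearMap.ker α ∈ A.hyps) : α ≠ 0 := by
  rintro rfl
  obtain ⟨β, hβ, h⟩ := A.isHyperplane _ h
  rw [LinearMap.ker_zero] at h
  exact hβ (LinearMap.ker_eq_top.1 h.symm)

theorem ker_resDual (H : Submodule F V) (κ : Module.Dual F V) :
    LinearMap.ker (resDual H κ) = (LinearMap.ker κ).comap H.subtype := by
  ext x
  simp

/-- Every form on `H` that defines `K ∩ H` extends to a form on `V` that defines `K`. -/
theorem exists_extension {H : Submodule F V} {κ : Module.Dual F V}
    (hK : ¬ H ≤ LinearMap.ker κ) {γ : Module.Dual F H}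
    (h : LinearMap.ker γ = (LinearMap.ker κ).comap H.subtype) :
    ∃ κ' : Module.Dual F V, LinearMap.ker κ' = LinearMap.ker κ ∧ resDual H κ' = γ := by
  rw [← ker_resDual] at h
  obtain ⟨c, hc⟩ := exists_smul_of_ker_le h.ge
  have hc0 : c ≠ 0 := by
    rintro rfl
    rw [zero_smul] at hc
    rw [hc, LinearMap.ker_zero] at h
    apply hK
    intro x hx
    have : (⟨x, hx⟩ : H) ∈ LinearMap.ker (resDual H κ) := h ▸ Submodule.mem_top
    exact this
  exact ⟨c • κ, LinearMap.ker_smul _ _ hc0, by rw [map_smul, hc]⟩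

theorem exists_form_of_mem_restriction {A : LinArr F V} {H : Submodule F V}
    {γ : Module.Dual F H} (h : LinearMap.ker γ ∈ (A.restriction H).hyps) :
    ∃ κ : Module.Dual F V, LinearMap.ker κ ∈ A.hyps ∧ ¬ H ≤ LinearMap.ker κ ∧
      resDual H κ = γ := by
  obtain ⟨K, hK, hHK, hker⟩ := h
  obtain ⟨κ, -, rfl⟩ := A.isHyperplane K hK
  obtain ⟨κ', h1, h2⟩ := exists_extension hHK hker
  exact ⟨κ', h1 ▸ hK, h1 ▸ hHK, h2⟩

/-- A derivation of `S(V^*)` that preserves the ideal of `ker α` induces a derivation of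
`S((ker α)^*)`. -/
theorem exists_restricted_derivation {H : Submodule F V} {α : Module.Dual F V}
    (hH : H = LinearMap.ker α) (θ : Derivation F (Sym F V) (Sym F V))
    (hθ : linForm α ∣ θ (linForm α)) :
    ∃ η : Derivation F (Sym F H) (Sym F H),
      ∀ β : Module.Dual F V, η (linForm (resDual H β)) = res H (θ (linForm β)) := by
  obtain ⟨s, hs⟩ := (resDual H).exists_rightInverse_of_surjective
    (LinearMap.range_eq_top.2 (resDual_surjective H))
  -- Forms on `H` are lifted by the section `s`. Another lift differs by `c • α`, and `α ∣ θ(α)`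
  -- makes the restricted value independent of the lift.
  refine ⟨mkDer ((res H).toLinearMap ∘ₗ (θ : Sym F V →ₗ[F] Sym F V) ∘ₗ
    SymmetricAlgebra.ι F (Module.Dual F V) ∘ₗ s), fun β => ?_⟩
  rw [mkDer_linForm]
  change res H (θ (linForm (s (resDual H β)))) = _
  rw [← sub_eq_zero, ← map_sub, ← map_sub, ← map_sub, res_eq_zero_iff_of_eq hH]
  have h2 : resDual H (s (resDual H β) - β) = 0 := by
    rw [map_sub, sub_eq_zero]
    exact LinearMap.congr_fun hs _
  obtain ⟨c, hc⟩ := exists_smul_of_resDual_eq_zero hH h2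
  rw [hc, map_smul, Derivation.map_smul, Algebra.smul_def]
  exact hθ.mul_left _

theorem restricted_mem_derModule {A : LinArr F V} {H : Submodule F V}
    {θ : Derivation F (Sym F V) (Sym F V)} (hθ : θ ∈ A.derModule)
    {η : Derivation F (Sym F H) (Sym F H)}
    (hη : ∀ β : Module.Dual F V, η (linForm (resDual H β)) = res H (θ (linForm β))) :
    η ∈ (A.restriction H).derModule := by
  intro γ hγ
  obtain ⟨κ, hκ, -, rfl⟩ := exists_form_of_mem_restriction hγ
  rw [hη, ← res_linForm]
  exact map_dvd (res H) (hθ κ hκ)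

/-- Powers of pairwise non-associated primes divide together. -/
theorem prod_prime_pow_dvd {R ι : Type*} [CommRing R] [IsDomain R] (s : Finset ι) (p : ι → R)
    (n : ι → ℕ) (f : R) (hp : ∀ i ∈ s, Prime (p i))
    (hne : ∀ i ∈ s, ∀ j ∈ s, i ≠ j → ¬ p i ∣ p j) (hd : ∀ i ∈ s, p i ^ n i ∣ f) :
    ∏ i ∈ s, p i ^ n i ∣ f := by
  classical
  induction s using Finset.induction_on with
  | empty => simp
  | insert a s ha ih =>
    obtain ⟨g, rfl⟩ := ih (fun i hi => hp i (by simp [hi]))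
      (fun i hi j hj => hne i (by simp [hi]) j (by simp [hj])) (fun i hi => hd i (by simp [hi]))
    rw [Finset.prod_insert ha, mul_comm]
    have hpa := hp a (by simp)
    refine mul_dvd_mul_left _ (hpa.pow_dvd_of_dvd_mul_left _ ?_ (hd a (by simp)))
    rw [hpa.dvd_finsetProd_iff]
    rintro ⟨i, hi, h⟩
    exact hne a (by simp) i (by simp [hi]) (fun h => ha (h ▸ hi)) (hpa.dvd_of_dvd_pow h)

theorem not_le_of_mem_deletion {A : LinArr F V} {H K : Submodule F V} {α : Module.Dual F V}
    (hH : H = LinearMap.ker α)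
    (hK : K ∈ (A.deletion (H)).hyps) : ¬ H ≤ K := by
  intro h
  obtain ⟨κ, hκ, rfl⟩ := A.isHyperplane K hK.1
  subst hH
  exact hK.2 (ker_eq_of_ker_le hκ h).symm

theorem deletion_comap_mem_restriction {A : LinArr F V} {H K : Submodule F V} {α : Module.Dual F V}
    (hH : H = LinearMap.ker α)
    (hK : K ∈ (A.deletion (H)).hyps) :
    K.comap (H).subtype ∈ (A.restriction (H)).hyps :=
  ⟨K, hK.1, not_le_of_mem_deletion hH hK, rfl⟩

/-- If `m` hyperplanes of the deletion cut out the same hyperplane `ker γ` of `H = ker α`, then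
`γ ^ (m - 1)` divides the restriction of `θ(α)`. -/
theorem pow_dvd_res {A : LinArr F V} {H : Submodule F V} {α : Module.Dual F V}
    (hH : H = LinearMap.ker α)
    {θ : Derivation F (Sym F V) (Sym F V)}
    (hθ : θ ∈ (A.deletion (H)).derModule) {γ : Module.Dual F (H)}
    (hγ : γ ≠ 0) (s : Finset (Submodule F V))
    (hs : ∀ K ∈ s, K ∈ (A.deletion (H)).hyps ∧
      K.comap (H).subtype = LinearMap.ker γ) :
    linForm γ ^ (s.card - 1) ∣ res (H) (θ (linForm α)) := by
  obtain hs0 | hs0 := Nat.eq_zero_or_pos s.card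
  · simp [hs0]
  obtain ⟨β, hβ⟩ := resDual_surjective H γ
  have hex : ∀ K ∈ s, ∃ κ : Module.Dual F V, LinearMap.ker κ = K ∧ resDual H κ = γ := by
    intro K hK
    obtain ⟨h1, h2⟩ := hs K hK
    obtain ⟨κ, -, rfl⟩ := A.isHyperplane K h1.1
    exact exists_extension (not_le_of_mem_deletion hH h1) h2.symm
  choose! κ hκ hκγ using hex
  have hκ0 : ∀ K ∈ s, κ K ≠ 0 := fun K hK h => hγ (by rw [← hκγ K hK, h, map_zero])
  -- `P` does not change when `β` is replaced by `κ K = β + c • α`, so each of the `m`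
  -- non-associated primes `κ K` divides it. On `H` the form `α` vanishes: `P` becomes `γ θ(α)`, the
  -- product of the `κ K` becomes `γ ^ m`, and one factor `γ` cancels.
  set P := linForm β * θ (linForm α) - linForm α * θ (linForm β) with hP
  have hdvd : ∏ K ∈ s, linForm (κ K) ^ 1 ∣ P := by
    refine prod_prime_pow_dvd s _ _ _ (fun K hK => linForm_prime (hκ0 K hK)) ?_ ?_
    · intro K hK L hL hne h
      rw [linForm_dvd_linForm_iff] at h
      apply hne
      rw [← hκ K hK, ← hκ L hL]
      exact ker_eq_of_ker_le (hκ0 L hL) h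
    · intro K hK
      rw [pow_one]
      have h2 : resDual H (κ K - β) = 0 := by rw [map_sub, hβ, hκγ K hK, sub_self]
      obtain ⟨c, hc⟩ := exists_smul_of_resDual_eq_zero hH h2
      have h3 : κ K = β + c • α := by rw [← hc]; abel
      have h4 : P = linForm (κ K) * θ (linForm α) - linForm α * θ (linForm (κ K)) := by
        rw [h3, linForm, map_add, map_smul, map_add, Derivation.map_smul, Algebra.smul_def,
          Algebra.smul_def, hP]
        ring
      rw [h4]
      refine dvd_sub (dvd_mul_right _ _) (Dvd.dvd.mul_left (hθ _ ?_) _)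
      rw [hκ K hK]
      exact (hs K hK).1
  have h5 := map_dvd (res H) hdvd
  have hα : res H (linForm α) = 0 := (res_eq_zero_iff_of_eq hH _).2 dvd_rfl
  rw [map_prod, hP, map_sub, map_mul, map_mul, hα, zero_mul, sub_zero, res_linForm, hβ,
    Finset.prod_congr rfl (fun K hK => by rw [pow_one, res_linForm, hκγ K hK]),
    Finset.prod_const, ← Nat.succ_pred_eq_of_pos hs0, pow_succ', Nat.pred_eq_sub_one,
    mul_dvd_mul_iff_left (linForm_ne_zero hγ)] at h5
  simpa using h5

/-- There is a homogeneous polynomial on `H = ker α` of degree `|A'| - |A''|` that divides the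
restrictions of all `θ(α)`, `θ ∈ D(A')`. -/
theorem exists_common_divisor (A : LinArr F V) {H : Submodule F V} {α : Module.Dual F V}
    (hH : H = LinearMap.ker α) {b : ℕ}
    (hcard : (A.deletion (H)).hyps.ncard =
      (A.restriction (H)).hyps.ncard + b) :
    ∃ B ∈ homogComponent F (H) b,
      ∀ θ ∈ (A.deletion (H)).derModule,
        B ∣ res (H) (θ (linForm α)) := by
  classical
  set s := (A.deletion H).finite.toFinset with hs
  set t := (A.restriction H).finite.toFinset with ht
  have hform := (A.restriction H).isHyperplane
  choose! γ hγ0 hγ using hform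
  -- A hyperplane of `A''` that is the trace of `m` hyperplanes of `A'` contributes `γ ^ (m - 1)` to
  -- `B`; summed over `A''` the exponents give `|A'| - |A''|`.
  let fib : Submodule F H → Finset (Submodule F V) :=
    fun X => s.filter fun K => K.comap H.subtype = X
  have hmaps : ∀ K ∈ s, K.comap H.subtype ∈ t := by
    intro K hK
    rw [hs, Set.Finite.mem_toFinset] at hK
    rw [ht, Set.Finite.mem_toFinset]
    exact deletion_comap_mem_restriction hH hK
  have hpos : ∀ X ∈ t, 1 ≤ (fib X).card := by
    intro X hX
    rw [ht, Set.Finite.mem_toFinset] at hX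
    obtain ⟨K, hK, hHK, rfl⟩ := hX
    refine Finset.card_pos.2 ⟨K, Finset.mem_filter.2 ⟨?_, rfl⟩⟩
    rw [hs, Set.Finite.mem_toFinset]
    exact ⟨hK, fun h => hHK (Set.mem_singleton_iff.1 h).ge⟩
  have hdeg : ∑ X ∈ t, ((fib X).card - 1) * 1 = b := by
    have h1 : s.card = ∑ X ∈ t, (fib X).card := Finset.card_eq_sum_card_fiberwise hmaps
    have h2 : ∑ X ∈ t, (fib X).card = ∑ X ∈ t, ((fib X).card - 1) * 1 + t.card := by
      rw [Finset.card_eq_sum_ones, ← Finset.sum_add_distrib]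
      refine Finset.sum_congr rfl fun X hX => ?_
      have := hpos X hX
      omega
    rw [Set.ncard_eq_toFinset_card _ (A.deletion H).finite,
      Set.ncard_eq_toFinset_card _ (A.restriction H).finite, ← hs, ← ht] at hcard
    omega
  refine ⟨∏ X ∈ t, linForm (γ X) ^ ((fib X).card - 1), ?_, fun θ hθ => ?_⟩
  · rw [← hdeg]
    exact prod_mem_homogComponent _ _ _ fun X _ =>
      pow_mem_homogComponent (linForm_mem_homogComponent _) _
  · refine prod_prime_pow_dvd _ _ _ _ ?_ ?_ ?_
    · intro X hX
      rw [ht, Set.Finite.mem_toFinset] at hX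
      exact linForm_prime (hγ0 X hX)
    · intro X hX Y hY hne h
      rw [ht, Set.Finite.mem_toFinset] at hX hY
      rw [linForm_dvd_linForm_iff] at h
      apply hne
      rw [hγ X hX, hγ Y hY]
      exact ker_eq_of_ker_le (hγ0 Y hY) h
    · intro X hX
      rw [ht, Set.Finite.mem_toFinset] at hX
      refine pow_dvd_res hH hθ (hγ0 X hX) _ fun K hK => ?_
      obtain ⟨h1, h2⟩ := Finset.mem_filter.1 hK
      rw [hs, Set.Finite.mem_toFinset] at h1
      exact ⟨h1, h2.trans (hγ X hX)⟩

/-- Division of a derivation by a linear form. -/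
theorem exists_smul_eq_of_dvd {α : Module.Dual F V} (hα : α ≠ 0)
    (θ : Derivation F (Sym F V) (Sym F V))
    (h : ∀ β : Module.Dual F V, linForm α ∣ θ (linForm β)) :
    ∃ η : Derivation F (Sym F V) (Sym F V), θ = linForm α • η := by
  choose q hq using h
  have h0 := linForm_ne_zero hα
  let f : Module.Dual F V →ₗ[F] Sym F V :=
    { toFun := q
      map_add' := fun x y => by
        apply mul_left_cancel₀ h0
        rw [mul_add, ← hq, ← hq, ← hq, linForm, map_add, map_add]
      map_smul' := fun c x => by
        apply mul_left_cancel₀ h0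
        rw [RingHom.id_apply, mul_smul_comm, ← hq, ← hq, linForm, map_smul,
          Derivation.map_smul] }
  refine ⟨mkDer f, derivation_ext fun β => ?_⟩
  rw [Derivation.smul_apply, mkDer_linForm, hq, smul_eq_mul]
  rfl

theorem mem_derModule_of_deletion {A : LinArr F V} {H : Submodule F V} {α : Module.Dual F V}
    (hH : H = LinearMap.ker α)
    {θ : Derivation F (Sym F V) (Sym F V)}
    (hθ : θ ∈ (A.deletion (H)).derModule) (h : linForm α ∣ θ (linForm α)) :
    θ ∈ A.derModule := by
  intro β hβ
  by_cases hk : LinearMap.ker β = H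
  · obtain ⟨c, rfl⟩ := exists_smul_of_ker_le (hk.trans hH).ge
    have hc : c ≠ 0 := by
      rintro rfl
      exact ne_zero_of_ker_mem hβ (zero_smul _ _)
    rw [linForm, map_smul, Derivation.map_smul, Algebra.smul_def, Algebra.smul_def]
    exact mul_dvd_mul_left _ h
  · exact hθ β ⟨hβ, hk⟩

theorem derModule_le_deletion (A : LinArr F V) (H : Submodule F V) :
    A.derModule ≤ (A.deletion H).derModule := fun _ hθ β hβ => hθ β hβ.1

/-- If `α η ∈ D(A')`, then `η ∈ D(A')`. -/
theorem mem_derModule_of_smul {A : LinArr F V} {H : Submodule F V} {α : Module.Dual F V}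
    (hH : H = LinearMap.ker α) (hα : α ≠ 0)
    {η : Derivation F (Sym F V) (Sym F V)}
    (h : linForm α • η ∈ (A.deletion (H)).derModule) :
    η ∈ (A.deletion (H)).derModule := by
  intro β hβ
  have h0 := ne_zero_of_ker_mem hβ
  have h1 := h β hβ
  rw [Derivation.smul_apply, smul_eq_mul] at h1
  refine ((linForm_prime h0).dvd_or_dvd h1).resolve_left fun h2 => ?_
  rw [linForm_dvd_linForm_iff] at h2
  exact hβ.2 ((ker_eq_of_ker_le hα h2).trans hH.symm)

/-- All `ζ i` lie in the span of the basis vectors satisfying `P`, a free module whose rank is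
smaller than the number of the `ζ i`. -/
theorem exists_dependency {R M ι : Type*} [CommRing R] [Nontrivial R] [AddCommGroup M]
    [Module R M] [Fintype ι] {l : ℕ} (η : Module.Basis (Fin l) R M) (P : Fin l → Prop)
    [DecidablePred P] (ζ : ι → M) (hζ : ∀ i j, ¬ P j → η.repr (ζ i) j = 0)
    (hcard : Fintype.card {j // P j} < Fintype.card ι) :
    ∃ g : ι → R, ∑ i, g i • ζ i = 0 ∧ ∃ i, g i ≠ 0 := by
  have hdep : ¬ LinearIndependent R fun i => fun j : {j // P j} => η.repr (ζ i) j := by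
    intro h
    have := h.fintype_card_le_finrank
    rw [Module.finrank_fintype_fun_eq_card] at this
    omega
  obtain ⟨g, hg, hg0⟩ := Fintype.not_linearIndependent_iff.1 hdep
  refine ⟨g, ?_, hg0⟩
  apply η.repr.injective
  ext j
  rw [map_sum, map_zero, Finsupp.coe_finsetSum, Finset.sum_apply]
  simp only [map_smul, Finsupp.smul_apply, smul_eq_mul, Finsupp.coe_zero, Pi.zero_apply]
  by_cases hj : P j
  · simpa using congrFun hg ⟨j, hj⟩
  · exact Finset.sum_eq_zero fun i _ => by rw [hζ i j hj, mul_zero]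

theorem coeff_of_sum_eq_smul {R M : Type*} [Semiring R] [AddCommMonoid M]
    [Module R M] {k : ℕ} (b : Module.Basis (Fin k) R M) (P : Fin k → Prop) [DecidablePred P]
    {f : {i // P i} → R} {a : R} {x : M} (h : ∑ i : {i // P i}, f i • b i = a • x)
    (i₁ : {i // P i}) : f i₁ = a * b.repr x i₁ := by
  have h6 := congrArg (fun x => b.repr x i₁) h
  simp only [map_sum, map_smul, Finsupp.coe_finsetSum, Finset.sum_apply, Finsupp.smul_apply,
    Module.Basis.repr_self, smul_eq_mul] at h6
  rwa [Finset.sum_eq_single i₁ (fun i _ hi => by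
    rw [Finsupp.single_eq_of_ne (fun h => hi (Subtype.ext h.symm)), mul_zero]) (by simp),
    Finsupp.single_eq_same, mul_one] at h6

set_option maxHeartbeats 400000 in
/-- In the situation of the addition theorem, some basis element of degree `b` of `D(A')` is not
in `D(A)`. -/
theorem exists_not_dvd {A : LinArr F V} {H : Submodule F V} {α : Module.Dual F V}
    (hH : H = LinearMap.ker α) (hα : α ≠ 0) {b : ℕ}
    (hcard : (A.deletion (H)).hyps.ncard =
      (A.restriction (H)).hyps.ncard + b)
    {k : ℕ} {d : Fin k → ℕ}
    (θ : Module.Basis (Fin k) (Sym F V) (A.deletion (H)).derModule)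
    (hθ : ∀ i, IsHomogDer (θ i : Derivation F (Sym F V) (Sym F V)) (d i))
    {l : ℕ} {e : Fin l → ℕ}
    (η : Module.Basis (Fin l) (Sym F (H))
      (A.restriction (H)).derModule)
    (hη : ∀ j, IsHomogDer
      (η j : Derivation F (Sym F (H)) (Sym F (H))) (e j))
    (hde : Finset.univ.val.map d = b ::ₘ Finset.univ.val.map e) :
    ∃ i, d i = b ∧
      ¬ linForm α ∣ (θ i : Derivation F (Sym F V) (Sym F V)) (linForm α) := by
  classical
  by_contra! hcon
  obtain ⟨B, hB, hBdvd⟩ := exists_common_divisor A hH hcard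
  -- Below degree `b` the multiple `θ i (α)` of `B` restricts to zero by degree; in degree `b`
  -- divisibility is the assumption to be refuted. So all basis elements of degree at most `b`
  -- induce elements of `D(A'')`.
  have hI : ∀ i, d i ≤ b →
      linForm α ∣ (θ i : Derivation F (Sym F V) (Sym F V)) (linForm α) := by
    intro i hi
    rcases hi.lt_or_eq with h | h
    · rw [← res_eq_zero_iff_of_eq hH]
      exact (exists_homog_quotient hB (res_mem_homogComponent H (hθ i α))
        (hBdvd _ (θ i).2)).2 h
    · exact hcon i h
  have hex : ∀ i : {i // d i ≤ b}, ∃ ζ : (A.restriction H).derModule,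
      ∀ β : Module.Dual F V, (ζ : Derivation F (Sym F H) (Sym F H)) (linForm (resDual H β)) =
        res H ((θ i : Derivation F (Sym F V) (Sym F V)) (linForm β)) := by
    intro i
    obtain ⟨ζ, hζ⟩ := exists_restricted_derivation hH _ (hI i i.2)
    exact ⟨⟨ζ, restricted_mem_derModule
      (mem_derModule_of_deletion hH (θ i).2 (hI i i.2)) hζ⟩, hζ⟩
  choose ζ hζ using hex
  have hζhom : ∀ i, IsHomogDer (ζ i : Derivation F (Sym F H) (Sym F H)) (d i) := by
    intro i γ
    obtain ⟨β, rfl⟩ := resDual_surjective H γ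
    rw [hζ]
    exact res_mem_homogComponent H (hθ i β)
  -- The additional exponent `b` of `A'` gives one more induced derivation than there are basis
  -- elements of `D(A'')` of degree at most `b`. By homogeneity only the latter occur in the
  -- expansions, so the induced derivations are dependent.
  have hcardIJ : Fintype.card {i // d i ≤ b} = Fintype.card {j // e j ≤ b} + 1 := by
    have h1 := congrArg (Multiset.countP (· ≤ b)) hde
    rw [Multiset.countP_cons, Multiset.countP_map, Multiset.countP_map, if_pos le_rfl] at h1
    rw [Fintype.card_subtype, Fintype.card_subtype]
    exact h1
  obtain ⟨g, hzero, i₁, hi₁⟩ := exists_dependency η (fun j => e j ≤ b) ζ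
    (fun i j hj => repr_of_isHomogDer η hη (ζ i) (hζhom i) j (by have := i.2; omega)) (by omega)
  -- With lifted coefficients, the combination of the `θ i` vanishes on `H`, hence equals `α • ξ`
  -- with `ξ ∈ D(A')`. Comparing coefficients in the basis `θ` gives `α ∣ f i`, so every `g i` is
  -- zero, a contradiction.
  choose f hf using fun i => res_surjective H (g i)
  have hΘ : ∀ β : Module.Dual F V, linForm α ∣
      (∑ i : {i // d i ≤ b}, f i • (θ i : Derivation F (Sym F V) (Sym F V))) (linForm β) := by
    intro β
    rw [← res_eq_zero_iff_of_eq hH, sum_derivation_apply, map_sum]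
    have h1 := congrArg (fun x : (A.restriction H).derModule =>
      (x : Derivation F (Sym F H) (Sym F H)) (linForm (resDual H β))) hzero
    simp only [coe_sum_smul, sum_derivation_apply, hζ] at h1
    simp only [map_mul, hf]
    exact h1
  obtain ⟨ξ, hξ⟩ := exists_smul_eq_of_dvd hα _ hΘ
  have hmem : (∑ i : {i // d i ≤ b}, f i • (θ i : Derivation F (Sym F V) (Sym F V))) ∈
      (A.deletion H).derModule :=
    Submodule.sum_mem _ fun i _ => Submodule.smul_mem _ _ (θ i).2
  have hξmem : ξ ∈ (A.deletion H).derModule := mem_derModule_of_smul hH hα (hξ ▸ hmem)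
  have hrepr : ∑ i : {i // d i ≤ b}, f i • θ i =
      linForm α • (⟨ξ, hξmem⟩ : (A.deletion H).derModule) := by
    apply Subtype.ext
    rw [coe_sum_smul, hξ]
    rfl
  apply hi₁
  have h6 := coeff_of_sum_eq_smul θ (fun i => d i ≤ b) hrepr i₁
  rw [← hf, h6]
  exact (res_eq_zero_iff_of_eq hH _).2 (dvd_mul_right _ _)

end Freeness

/-! ### The addition theorem. -/

section Addition

variable {F V : Type*} [Field F] [AddCommGroup V] [Module F V]

/-- The value `p i₀ = 1 - a` encodes the replacement of `b i₀` by `a • b i₀`. An element of `N` with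
coefficients `f` differs from the combination of the new vectors with the same coefficients by a
multiple of `b i₀` lying in `N`, which `hdvd` turns into a multiple of `a • b i₀`. -/
theorem exists_exchanged_basis {R E : Type*} [CommRing R] [IsDomain R] [AddCommGroup E]
    [Module R E] {N N' : Submodule R E} (hN : N ≤ N') {k : ℕ} (b : Module.Basis (Fin k) R N')
    (i₀ : Fin k) {a : R} (ha : a ≠ 0) (p : Fin k → R) (hp : p i₀ = 1 - a)
    (hmem : ∀ i, (b i : E) - p i • (b i₀ : E) ∈ N)
    (hdvd : ∀ t : R, t • (b i₀ : E) ∈ N → a ∣ t) :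
    ∃ b' : Module.Basis (Fin k) R N, ∀ i, (b' i : E) = (b i : E) - p i • (b i₀ : E) := by
  classical
  let v : Fin k → N := fun i => ⟨_, hmem i⟩
  have hli : LinearIndependent R v := by
    rw [Fintype.linearIndependent_iff]
    intro c hc
    have h1 : ∑ i, c i • b i = (∑ i, c i * p i) • b i₀ := by
      apply Subtype.ext
      have h2 := congrArg (Subtype.val : N → E) hc
      push_cast [v] at h2
      simp only [smul_sub, Finset.sum_sub_distrib, smul_smul] at h2
      rw [← Finset.sum_smul] at h2
      push_cast
      exact sub_eq_zero.1 h2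
    have h3 : ∀ i, c i = (∑ i, c i * p i) * (if i₀ = i then 1 else 0) := by
      intro i
      have h4 := congrArg (fun x => b.repr x i) h1
      simp only [b.repr_sum_self, map_smul, Finsupp.smul_apply, Module.Basis.repr_self,
        smul_eq_mul, Finsupp.single_apply] at h4
      exact h4
    have h5 : ∀ i, i ≠ i₀ → c i = 0 := fun i hi => by rw [h3, if_neg hi.symm, mul_zero]
    have h6 : c i₀ = 0 := by
      have h7 := h3 i₀
      rw [if_pos rfl, mul_one, Finset.sum_eq_single i₀
        (fun i _ hi => by rw [h5 i hi, zero_mul]) (by simp), hp] at h7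
      have h8 : c i₀ * a = 0 := by linear_combination h7
      exact (mul_eq_zero.1 h8).resolve_right ha
    intro i
    by_cases hi : i = i₀
    · rw [hi, h6]
    · exact h5 i hi
  have hspan : ⊤ ≤ Submodule.span R (Set.range v) := by
    intro x _
    set f := b.repr ⟨x, hN x.2⟩ with hf
    have hx : (x : E) = ∑ i, f i • (b i : E) := by
      have := congrArg (Subtype.val : N' → E) (b.sum_repr ⟨x, hN x.2⟩)
      push_cast at this
      exact this.symm
    have h1 : (x : E) = ∑ i, f i • (v i : E) + (∑ i, f i * p i) • (b i₀ : E) := by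
      simp only [v, smul_sub, Finset.sum_sub_distrib, smul_smul]
      rw [← Finset.sum_smul, ← hx]
      abel
    obtain ⟨u, hu⟩ := hdvd (∑ i, f i * p i) (by
      rw [← sub_eq_iff_eq_add'] at h1
      rw [← h1]
      exact sub_mem x.2 (sum_mem fun i _ => N.smul_mem _ (v i).2))
    have h2 : x = ∑ i, f i • v i + u • v i₀ := by
      apply Subtype.ext
      rw [h1, hu]
      push_cast [v]
      rw [hp]
      module
    rw [h2]
    exact add_mem (sum_mem fun i _ => Submodule.smul_mem _ _ (Submodule.subset_span ⟨i, rfl⟩))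
      (Submodule.smul_mem _ _ (Submodule.subset_span ⟨i₀, rfl⟩))
  refine ⟨Module.Basis.mk hli hspan, fun i => ?_⟩
  rw [Module.Basis.mk_apply]

theorem map_update_univ {k : ℕ} (d : Fin k → ℕ) (i₀ : Fin k) (c : ℕ) {e : Multiset ℕ}
    (h : Finset.univ.val.map d = d i₀ ::ₘ e) :
    Finset.univ.val.map (Function.update d i₀ c) = c ::ₘ e := by
  have h1 : (Finset.univ : Finset (Fin k)).val = i₀ ::ₘ (Finset.univ.erase i₀).val := by
    rw [← Finset.insert_val_of_notMem (Finset.notMem_erase _ _),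
      Finset.insert_erase (Finset.mem_univ _)]
  rw [h1, Multiset.map_cons, Multiset.cons_inj_right] at h
  rw [h1, Multiset.map_cons, Function.update_self, ← h]
  congr 1
  refine Multiset.map_congr rfl fun i hi => ?_
  exact Function.update_of_ne (Finset.ne_of_mem_erase (s := Finset.univ) hi) _ _

set_option maxHeartbeats 400000 in
/-- The addition theorem for free arrangements. -/
theorem FreeWithExponents.addition {A : LinArr F V} {H : Submodule F V} (hH : H ∈ A.hyps)
    {b : ℕ} {e : Multiset ℕ} (h' : (A.deletion H).FreeWithExponents (b ::ₘ e))
    (h'' : (A.restriction H).FreeWithExponents e)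
    (hcard : (A.deletion H).hyps.ncard = (A.restriction H).hyps.ncard + b) :
    A.FreeWithExponents ((b + 1) ::ₘ e) := by
  obtain ⟨α, hα, hHα⟩ := A.isHyperplane H hH
  obtain ⟨k, d, θ, hθ, hd⟩ := h'
  obtain ⟨l, e', η, hη, rfl⟩ := h''
  obtain ⟨i₀, hi₀, hnd⟩ := exists_not_dvd hHα hα hcard θ hθ η hη hd
  obtain ⟨B, hB, hBdvd⟩ := exists_common_divisor A hHα hcard
  obtain ⟨g₀, hg₀, hg₀B⟩ := (exists_homog_quotient hB (res_mem_homogComponent H (hθ i₀ α))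
    (hBdvd _ (θ i₀).2)).1 hi₀.ge
  -- The quotient by `B` has degree `d i₀ - b = 0`, so it is a scalar, nonzero because `α` does not
  -- divide `θ i₀ (α)`. Hence a multiple of `θ i₀` can be subtracted from any other `θ i` to make
  -- its value at `α` vanish on `H`, without changing its degree.
  have hc : ∃ c : F, algebraMap F _ c = g₀ := by
    rw [hi₀, Nat.sub_self, homogComponent, pow_zero] at hg₀
    exact Submodule.mem_one.1 hg₀
  obtain ⟨c, rfl⟩ := hc
  have hc : c ≠ 0 := by
    rintro rfl
    rw [map_zero, zero_mul, res_eq_zero_iff_of_eq hHα] at hg₀B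
    exact hnd hg₀B
  have hquot : ∀ i, ∃ p : Sym F V, IsHomogDer ((θ i : Derivation F (Sym F V) (Sym F V)) -
        p • (θ i₀ : Derivation F (Sym F V) (Sym F V))) (d i) ∧
      linForm α ∣ ((θ i : Derivation F (Sym F V) (Sym F V)) -
        p • (θ i₀ : Derivation F (Sym F V) (Sym F V))) (linForm α) := by
    intro i
    obtain ⟨hle, hlt⟩ := exists_homog_quotient hB (res_mem_homogComponent H (hθ i α))
      (hBdvd _ (θ i).2)
    by_cases hi : b ≤ d i
    · obtain ⟨g, hg, hgB⟩ := hle hi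
      obtain ⟨p, hp, hpg⟩ := exists_res_eq_of_mem H hg
      refine ⟨algebraMap F _ c⁻¹ * p, ?_, ?_⟩
      · intro β
        rw [Derivation.sub_apply, Derivation.smul_apply, smul_eq_mul]
        refine sub_mem (hθ i β) ?_
        have h1 : d i = (0 + (d i - b)) + d i₀ := by omega
        rw [h1]
        exact mul_mem_homogComponent (mul_mem_homogComponent (algebraMap_mem_homogComponent _) hp)
          (hθ i₀ β)
      · rw [← res_eq_zero_iff_of_eq hHα, Derivation.sub_apply, Derivation.smul_apply,
          smul_eq_mul, map_sub, map_mul, map_mul, hgB, hg₀B, hpg, AlgHom.commutes]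
        have h2 : algebraMap F (Sym F H) c⁻¹ * algebraMap F (Sym F H) c = 1 := by
          rw [← map_mul, inv_mul_cancel₀ hc, map_one]
        linear_combination (-(g * B)) * h2
    · refine ⟨0, ?_, ?_⟩
      · rw [zero_smul, sub_zero]
        exact hθ i
      · rw [zero_smul, sub_zero, ← res_eq_zero_iff_of_eq hHα]
        exact hlt (not_le.1 hi)
  choose p hphom hpdvd using hquot
  obtain ⟨b', hb'⟩ := exists_exchanged_basis (derModule_le_deletion A H) θ i₀
    (linForm_ne_zero hα) (Function.update p i₀ (1 - linForm α)) (by simp)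
    (fun i => by
      refine mem_derModule_of_deletion hHα
        (sub_mem (θ i).2 (Submodule.smul_mem _ _ (θ i₀).2)) ?_
      by_cases hi : i = i₀
      · subst hi
        rw [Function.update_self, Derivation.sub_apply, Derivation.smul_apply, smul_eq_mul]
        exact ⟨(θ i : Derivation F (Sym F V) (Sym F V)) (linForm α), by ring⟩
      · rw [Function.update_of_ne hi]
        exact hpdvd i)
    (fun t ht => by
      have h1 := ht α (hHα ▸ hH)
      rw [Derivation.smul_apply, smul_eq_mul] at h1
      exact ((linForm_prime hα).dvd_or_dvd h1).resolve_right hnd)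
  refine ⟨k, Function.update d i₀ (b + 1), b', fun i => ?_, ?_⟩
  · rw [hb']
    by_cases hi : i = i₀
    · subst hi
      intro β
      rw [Function.update_self, Function.update_self, Derivation.sub_apply, Derivation.smul_apply,
        smul_eq_mul, add_comm b 1]
      have h3 : (θ i : Derivation F (Sym F V) (Sym F V)) (linForm β) -
          (1 - linForm α) * (θ i : Derivation F (Sym F V) (Sym F V)) (linForm β) =
          linForm α * (θ i : Derivation F (Sym F V) (Sym F V)) (linForm β) := by ring
      rw [h3]
      exact mul_mem_homogComponent (linForm_mem_homogComponent α) (hi₀ ▸ hθ i β)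
    · rw [Function.update_of_ne hi, Function.update_of_ne hi]
      exact hphom i
  · exact map_update_univ d i₀ _ (by rw [hi₀]; exact hd)

theorem exists_basis_of_coefficients {R M : Type*} [Semiring R] [AddCommMonoid M] [Module R M]
    {k : ℕ} (v : Fin k → M) (coeff : M → Fin k → R)
    (h₁ : ∀ c : Fin k → R, coeff (∑ i, c i • v i) = c)
    (h₂ : ∀ x, x = ∑ i, coeff x i • v i) :
    ∃ b : Module.Basis (Fin k) R M, ∀ i, b i = v i := by
  classical
  let f : (Fin k → R) →ₗ[R] M :=
    { toFun := fun c => ∑ i, c i • v i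
      map_add' := fun x y => by simp [add_smul, Finset.sum_add_distrib]
      map_smul' := fun a x => by simp [Finset.smul_sum, mul_smul] }
  let E := LinearEquiv.ofBijective f
    ⟨Function.LeftInverse.injective (g := coeff) h₁, fun x => ⟨coeff x, (h₂ x).symm⟩⟩
  refine ⟨Module.Basis.ofEquivFun E.symm, fun i => ?_⟩
  rw [Module.Basis.coe_ofEquivFun]
  change ∑ j, (Pi.single i (1 : R) : Fin k → R) j • v j = v i
  rw [Finset.sum_eq_single i (fun j _ hj => by rw [Pi.single_eq_of_ne hj, zero_smul]) (by simp),
    Pi.single_eq_same, one_smul]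

/-- The empty arrangement is free with exponents `0`. -/
theorem freeWithExponents_empty [FiniteDimensional F V] :
    (empty F V).FreeWithExponents (Multiset.replicate (Module.finrank F V) 0) := by
  classical
  let β := Module.finBasis F (Module.Dual F V)
  have hmem : ∀ θ, θ ∈ (empty F V).derModule := fun θ α hα => absurd hα (Set.notMem_empty _)
  -- The partial derivatives for the basis `β` of linear forms; the coefficients of a derivation are
  -- its values on `β`.
  let D : Fin (Module.finrank F (Module.Dual F V)) → Derivation F (Sym F V) (Sym F V) :=
    fun i => mkDer (Algebra.linearMap F (Sym F V) ∘ₗ β.coord i)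
  have hD : ∀ i α, D i (linForm α) = algebraMap F _ (β.repr α i) := fun i α => by
    rw [mkDer_linForm]
    rfl
  let v : Fin (Module.finrank F (Module.Dual F V)) → (empty F V).derModule :=
    fun i => ⟨D i, hmem _⟩
  have heval : ∀ (c : Fin (Module.finrank F (Module.Dual F V)) → Sym F V) (α : Module.Dual F V),
      ((∑ i, c i • v i : (empty F V).derModule) : Derivation F (Sym F V) (Sym F V)) (linForm α) =
        ∑ i, c i * algebraMap F _ (β.repr α i) := by
    intro c α
    rw [coe_sum_smul, sum_derivation_apply]
    exact Finset.sum_congr rfl fun i _ => by rw [← hD]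
  have hself : ∀ (c : Fin (Module.finrank F (Module.Dual F V)) → Sym F V) j,
      ∑ i, c i * algebraMap F _ (β.repr (β j) i) = c j := by
    intro c j
    rw [Finset.sum_eq_single j (fun i _ hi => by
      rw [β.repr_self, Finsupp.single_eq_of_ne hi, map_zero, mul_zero]) (by simp),
      β.repr_self, Finsupp.single_eq_same, map_one, mul_one]
  obtain ⟨b, hb⟩ := exists_basis_of_coefficients v
    (fun θ i => (θ : Derivation F (Sym F V) (Sym F V)) (linForm (β i)))
    (fun c => funext fun j => by rw [heval, hself])
    (fun θ => by
      apply Subtype.ext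
      apply derivation_ext
      intro α
      rw [heval]
      have h2 : linForm α = ∑ i, β.repr α i • linForm (β i) := by
        conv_lhs => rw [← β.sum_repr α]
        rw [linForm, map_sum]
        exact Finset.sum_congr rfl fun i _ => by rw [map_smul]
      conv_lhs => rw [h2]
      rw [map_sum]
      exact Finset.sum_congr rfl fun i _ => by
        rw [Derivation.map_smul, Algebra.smul_def, mul_comm])
  refine ⟨_, fun _ => 0, b, fun i α => ?_, ?_⟩
  · rw [hb]
    change D i (linForm α) ∈ _
    rw [hD]
    exact algebraMap_mem_homogComponent _
  · rw [Multiset.map_const', Finset.card_val, Finset.card_univ, Fintype.card_fin,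
      Subspace.dual_finrank_eq]

end Addition

-- Arrangements built by repeated addition.

universe u v

/-- An arrangement that is built from the empty arrangement by the addition theorem, with
exponents `e`. -/
structure IsGood {F : Type u} [Field F] {V : Type v} [AddCommGroup V] [Module F V]
    (A : LinArr F V) (e : Multiset ℕ) : Prop where
  inductivelyFree : A.InductivelyFree
  free : A.FreeWithExponents e
  ncard : A.hyps.ncard = e.sum
  charPoly : A.IsCharPoly (e.map fun i : ℕ => Polynomial.X - (i : Polynomial ℤ)).prod

section Good

variable {F : Type u} [Field F] {V : Type v} [AddCommGroup V] [Module F V]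

theorem isGood_empty [FiniteDimensional F V] :
    (empty F V).IsGood (Multiset.replicate (Module.finrank F V) 0) where
  inductivelyFree := .empty V
  free := freeWithExponents_empty
  ncard := by simp [empty]
  charPoly := by simpa using IsCharPoly.empty (F := F) V

/-- The exponents sum to the number of hyperplanes, so `|A'| - |A''| = b` holds automatically. The
polynomials match by `(t - b - 1) P = (t - b) P - P`. -/
theorem IsGood.addition {A : LinArr F V} {H : Submodule F V} (hH : H ∈ A.hyps)
    {b : ℕ} {e : Multiset ℕ} (h' : (A.deletion H).IsGood (b ::ₘ e))
    (h'' : (A.restriction H).IsGood e) : A.IsGood ((b + 1) ::ₘ e) where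
  inductivelyFree := .add A H hH _ _ h'.inductivelyFree h''.inductivelyFree h'.free h''.free
    (Multiset.le_cons_self _ _)
  free := h'.free.addition hH h''.free (by
    rw [h'.ncard, h''.ncard, Multiset.sum_cons, add_comm])
  ncard := by
    have h1 : A.hyps.ncard = (A.deletion H).hyps.ncard + 1 :=
      (Set.ncard_sdiff_singleton_add_one hH A.finite).symm
    rw [h1, h'.ncard, Multiset.sum_cons, Multiset.sum_cons]
    ring
  charPoly := by
    have h1 := IsCharPoly.step A H hH _ _ h'.charPoly h''.charPoly
    have h2 : ∀ P : Polynomial ℤ, (Polynomial.X - ((b + 1 : ℕ) : Polynomial ℤ)) * P =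
        (Polynomial.X - (b : Polynomial ℤ)) * P - P := by
      intro P
      push_cast
      ring
    rw [Multiset.map_cons, Multiset.prod_cons] at h1 ⊢
    rwa [h2]

end Good

/-! ### Pinned Shi arrangements: deletion, restriction and coincidences among hyperplanes. -/

section ShiFamily

variable {F V ι : Type*} [Field F] [AddCommGroup V] [Module F V]

/-- The forms `z` and `y_i`, `i ∈ s`, take arbitrary values. -/
def Indep (z : Module.Dual F V) (y : ι → Module.Dual F V) (s : Finset ι) : Prop :=
  ∀ (a : F) (b : ι → F), ∃ x : V, z x = a ∧ ∀ i ∈ s, y i x = b i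

/-- The form `z` and the differences of the `y_i`, `i ∈ s`, take arbitrary values. -/
def AffIndep (z : Module.Dual F V) (y : ι → Module.Dual F V) (s : Finset ι) : Prop :=
  ∀ (a : F) (b : ι → F), ∃ x : V, z x = a ∧ ∀ i ∈ s, ∀ j ∈ s, y j x - y i x = b j - b i

theorem Indep.affIndep {z : Module.Dual F V} {y : ι → Module.Dual F V} {s : Finset ι}
    (h : Indep z y s) : AffIndep z y s := by
  intro a b
  obtain ⟨x, hx, hxs⟩ := h a b
  exact ⟨x, hx, fun i hi j hj => by rw [hxs i hi, hxs j hj]⟩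

theorem ker_sub_comm (α β : Module.Dual F V) :
    LinearMap.ker (α - β) = LinearMap.ker (β - α) := by
  ext x
  simp [sub_eq_zero, eq_comm (a := α x)]

/-- Distinct hyperplanes are never nested, so every member of the deletion has a trace in the
restriction. -/
theorem restriction_hyps {A : LinArr F V} {H : Submodule F V} {α : Module.Dual F V}
    (hH : H = LinearMap.ker α) :
    (A.restriction H).hyps = (fun K => K.comap H.subtype) '' (A.deletion H).hyps := by
  ext L
  constructor
  · rintro ⟨K, hK, hHK, rfl⟩
    exact ⟨K, ⟨hK, fun h => hHK (Set.mem_singleton_iff.1 h).ge⟩, rfl⟩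
  · rintro ⟨K, hK, rfl⟩
    exact ⟨K, hK.1, not_le_of_mem_deletion hH hK, rfl⟩

/-- On `y_k = 0` the `y_i` are no longer all free, but their differences are: prescribe `y_i = b i -
b k`. -/
theorem Indep.restrict_affIndep {z : Module.Dual F V} {y : ι → Module.Dual F V} {s : Finset ι}
    (h : Indep z y s) {k : ι} (hk : k ∈ s) {H : Submodule F V}
    (hH : H = LinearMap.ker (y k - (0 : F) • z)) :
    AffIndep (resDual H z) (fun i => resDual H (y i)) s := by
  intro a b
  obtain ⟨x, hx, hxs⟩ := h a (fun i => b i - b k)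
  refine ⟨⟨x, by rw [hH]; simp [hxs k hk]⟩, hx, fun i hi j hj => ?_⟩
  change y j x - y i x = _
  rw [hxs i hi, hxs j hj]
  ring

theorem resDual_eq_smul {z : Module.Dual F V} {α : Module.Dual F V} {c : F} {H : Submodule F V}
    (hH : H = LinearMap.ker (α - c • z)) : resDual H α = c • resDual H z := by
  ext x
  have hx : (x : V) ∈ LinearMap.ker (α - c • z) := hH ▸ x.2
  simpa [sub_eq_zero] using hx

theorem Indep.sub_smul_ne_zero {z : Module.Dual F V} {y : ι → Module.Dual F V} {s : Finset ι}
    (h : Indep z y s) {k : ι} (hk : k ∈ s) (c : F) : y k - c • z ≠ 0 := by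
  intro h0
  obtain ⟨x, hx, hxs⟩ := h 0 fun _ => 1
  have := LinearMap.congr_fun h0 x
  simp [hx, hxs k hk] at this

theorem finrank_of_eq_ker [FiniteDimensional F V] {α : Module.Dual F V} (hα : α ≠ 0)
    {H : Submodule F V} (hH : H = LinearMap.ker α) {d : ℕ}
    (hV : Module.finrank F V = d + 1) : Module.finrank F H = d := by
  subst hH
  have := Module.Dual.finrank_ker_add_one_of_ne_zero hα
  omega

variable [LinearOrder ι]

/-- The hyperplanes `z = 0`, `y_j - y_i ∈ {0, z}` for `i < j` in `s`, and `y_i = c z` for `i ∈ s`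
and `c < u i`. -/
def shiHyps (z : Module.Dual F V) (y : ι → Module.Dual F V) (s : Finset ι) (u : ι → ℕ) :
    Set (Submodule F V) :=
  {K | K = LinearMap.ker z ∨
    (∃ i ∈ s, ∃ j ∈ s, i < j ∧
      (K = LinearMap.ker (y j - y i) ∨ K = LinearMap.ker (y j - y i - z))) ∨
    ∃ i ∈ s, ∃ c < u i, K = LinearMap.ker (y i - (c : F) • z)}

theorem shiHyps_congr {z : Module.Dual F V} {y : ι → Module.Dual F V} {s : Finset ι}
    {u u' : ι → ℕ} (h : ∀ i ∈ s, u i = u' i) : shiHyps z y s u = shiHyps z y s u' := by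
  ext K
  refine or_congr Iff.rfl (or_congr Iff.rfl (exists_congr fun i => ?_))
  exact and_congr_right fun hi => by rw [h i hi]

/-- Members may coincide after restriction; `shiHyps_erase` and `shiHyps_of_eq_zero` then find a
nonredundant description. -/
theorem image_comap_shiHyps (H : Submodule F V) (z : Module.Dual F V) (y : ι → Module.Dual F V)
    (s : Finset ι) (u : ι → ℕ) :
    (fun K => K.comap H.subtype) '' shiHyps z y s u =
      shiHyps (resDual H z) (fun i => resDual H (y i)) s u := by
  ext L
  constructor
  · rintro ⟨K, rfl | ⟨i, hi, j, hj, hij, rfl | rfl⟩ | ⟨i, hi, c, hc, rfl⟩, rfl⟩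
    · exact Or.inl (ker_resDual H z).symm
    · exact Or.inr (Or.inl ⟨i, hi, j, hj, hij, Or.inl (by
        rw [← map_sub]; exact (ker_resDual H _).symm)⟩)
    · exact Or.inr (Or.inl ⟨i, hi, j, hj, hij, Or.inr (by
        rw [← map_sub, ← map_sub]; exact (ker_resDual H _).symm)⟩)
    · exact Or.inr (Or.inr ⟨i, hi, c, hc, by
        rw [← map_smul, ← map_sub]; exact (ker_resDual H _).symm⟩)
  · rintro (rfl | ⟨i, hi, j, hj, hij, rfl | rfl⟩ | ⟨i, hi, c, hc, rfl⟩)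
    · exact ⟨_, Or.inl rfl, (ker_resDual H z).symm⟩
    · exact ⟨_, Or.inr (Or.inl ⟨i, hi, j, hj, hij, Or.inl rfl⟩), by
        rw [← map_sub]; exact (ker_resDual H _).symm⟩
    · exact ⟨_, Or.inr (Or.inl ⟨i, hi, j, hj, hij, Or.inr rfl⟩), by
        rw [← map_sub, ← map_sub]; exact (ker_resDual H _).symm⟩
    · exact ⟨_, Or.inr (Or.inr ⟨i, hi, c, hc, rfl⟩), by
        rw [← map_smul, ← map_sub]; exact (ker_resDual H _).symm⟩

/-- The hyperplane `y_k = N z` is new. -/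
theorem notMem_shiHyps [CharZero F] {z : Module.Dual F V} {y : ι → Module.Dual F V}
    {s : Finset ι} (h : Indep z y s) {u : ι → ℕ} {k : ι} (hk : k ∈ s) {N : ℕ} (hN : u k = N) :
    LinearMap.ker (y k - (N : F) • z) ∉ shiHyps z y s u := by
  -- Each member of the family is separated from `y_k = N z` by a point of the latter: `z = 1` with
  -- all `y_i = N` against `z = 0` and `y_k = c z`, and `z = 0` with a single nonzero `y_i`, `i ≠
  -- k`, against the others.
  have key : ∀ (β : Module.Dual F V) (x : V), y k x = N * z x → β x ≠ 0 →
      LinearMap.ker (y k - (N : F) • z) ≠ LinearMap.ker β := by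
    intro β x hx hβ heq
    apply hβ
    have : x ∈ LinearMap.ker (y k - (N : F) • z) := by simp [hx]
    rw [heq] at this
    exact this
  rintro (h1 | ⟨i, hi, j, hj, hij, h1 | h1⟩ | ⟨i, hi, c, hc, h1⟩)
  · obtain ⟨x, hx, hxs⟩ := h 1 fun _ => (N : F)
    exact key z x (by rw [hx, hxs k hk, mul_one]) (by rw [hx]; exact one_ne_zero) h1
  all_goals by_cases hik : i = k
  · subst hik
    obtain ⟨x, hx, hxs⟩ := h 0 (Pi.single j 1)
    exact key _ x (by rw [hx, hxs i hk, Pi.single_eq_of_ne hij.ne, mul_zero])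
      (by simp [hxs i hi, hxs j hj, hij.ne]) h1
  · obtain ⟨x, hx, hxs⟩ := h 0 (Pi.single i 1)
    exact key _ x (by rw [hx, hxs k hk, Pi.single_eq_of_ne (Ne.symm hik), mul_zero])
      (by simp [hxs i hi, hxs j hj, hij.ne']) h1
  · subst hik
    obtain ⟨x, hx, hxs⟩ := h 0 (Pi.single j 1)
    exact key _ x (by rw [hx, hxs i hk, Pi.single_eq_of_ne hij.ne, mul_zero])
      (by simp [hx, hxs i hi, hxs j hj, hij.ne]) h1
  · obtain ⟨x, hx, hxs⟩ := h 0 (Pi.single i 1)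
    exact key _ x (by rw [hx, hxs k hk, Pi.single_eq_of_ne (Ne.symm hik), mul_zero])
      (by simp [hx, hxs i hi, hxs j hj, hij.ne']) h1
  · subst hik
    obtain ⟨x, hx, hxs⟩ := h 1 fun _ => (N : F)
    refine key _ x (by rw [hx, hxs i hk, mul_one]) ?_ h1
    simp only [LinearMap.sub_apply, LinearMap.smul_apply, hx, hxs i hi, smul_eq_mul, mul_one]
    rw [sub_ne_zero]
    exact_mod_cast (by omega : N ≠ c)
  · obtain ⟨x, hx, hxs⟩ := h 0 (Pi.single i 1)
    exact key _ x (by rw [hx, hxs k hk, Pi.single_eq_of_ne (Ne.symm hik), mul_zero])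
      (by simp [hx, hxs i hi]) h1

theorem shiHyps_deletion [CharZero F] {z : Module.Dual F V} {y : ι → Module.Dual F V}
    {s : Finset ι} (h : Indep z y s) {u u' : ι → ℕ} {k : ι} (hk : k ∈ s) {N : ℕ}
    (hN : u k = N) (hN' : u' k = N + 1) (hu : ∀ i, i ≠ k → u' i = u i) {A : LinArr F V}
    (hA : A.hyps = shiHyps z y s u') :
    LinearMap.ker (y k - (N : F) • z) ∈ A.hyps ∧
      (A.deletion (LinearMap.ker (y k - (N : F) • z))).hyps = shiHyps z y s u := by
  have hins :
      shiHyps z y s u' = insert (LinearMap.ker (y k - (N : F) • z)) (shiHyps z y s u) := by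
    ext K
    constructor
    · rintro (h1 | h1 | ⟨i, hi, c, hc, h1⟩)
      · exact Or.inr (Or.inl h1)
      · exact Or.inr (Or.inr (Or.inl h1))
      · by_cases hik : i = k
        · subst hik
          rcases (by omega : c = N ∨ c < u i) with rfl | hc'
          · exact Or.inl h1
          · exact Or.inr (Or.inr (Or.inr ⟨i, hi, c, hc', h1⟩))
        · exact Or.inr (Or.inr (Or.inr ⟨i, hi, c, hu i hik ▸ hc, h1⟩))
    · rintro (h1 | h1 | h1 | ⟨i, hi, c, hc, h1⟩)
      · exact Or.inr (Or.inr ⟨k, hk, N, by omega, h1⟩)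
      · exact Or.inl h1
      · exact Or.inr (Or.inl h1)
      · refine Or.inr (Or.inr ⟨i, hi, c, ?_, h1⟩)
        by_cases hik : i = k
        · subst hik
          omega
        · rwa [hu i hik]
  refine ⟨hA ▸ hins ▸ Set.mem_insert _ _, ?_⟩
  change A.hyps \ {_} = _
  rw [hA, hins, Set.insert_sdiff_self_of_notMem (notMem_shiHyps h hk hN)]

/-- Elimination of a vertex `k` whose coordinate has become `N z`. -/
theorem shiHyps_erase [CharZero F] {z : Module.Dual F V} {y : ι → Module.Dual F V}
    {s : Finset ι} {u : ι → ℕ} {k : ι} (hk : k ∈ s) {N : ℕ} (hN : 1 ≤ N) (hy : y k = (N : F) • z)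
    (huk : u k = N) (hgt : ∀ j ∈ s, k < j → u j = N + 1) (hlt : ∀ i ∈ s, i < k → u i = N) :
    shiHyps z y s u = shiHyps z y (s.erase k) (fun i => u i + 1) := by
  -- For `j > k` the differences with `y_k = N z` give `y_j = N z`, already a pin, and `y_j = (N +
  -- 1) z`, a new one. For `i < k` they give `y_i = N z`, new, and `y_i = (N - 1) z`, a pin already
  -- because `N ≥ 1`. So each count rises by exactly one, and the pins of `k` itself collapse to `z
  -- = 0`.
  obtain ⟨M, rfl⟩ : ∃ M, N = M + 1 := ⟨N - 1, by omega⟩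
  ext K
  constructor
  · rintro (h1 | ⟨i, hi, j, hj, hij, h1⟩ | ⟨i, hi, c, hc, h1⟩)
    · exact Or.inl h1
    · by_cases hik : i = k
      · subst hik
        have hj' : j ∈ s.erase i := Finset.mem_erase.2 ⟨hij.ne', hj⟩
        have := hgt j hj hij
        rcases h1 with h1 | h1
        · exact Or.inr (Or.inr ⟨j, hj', M + 1, by dsimp only; omega, by rw [h1, hy]⟩)
        · refine Or.inr (Or.inr ⟨j, hj', M + 1 + 1, by dsimp only; omega, ?_⟩)
          rw [h1, hy]
          congr 1
          push_cast
          module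
      · have hi' : i ∈ s.erase k := Finset.mem_erase.2 ⟨hik, hi⟩
        by_cases hjk : j = k
        · subst hjk
          have := hlt i hi hij
          rcases h1 with h1 | h1
          · exact Or.inr (Or.inr ⟨i, hi', M + 1, by dsimp only; omega, by rw [h1, hy, ker_sub_comm]⟩)
          · refine Or.inr (Or.inr ⟨i, hi', M, by dsimp only; omega, ?_⟩)
            rw [h1, hy, ker_sub_comm (y i)]
            congr 1
            push_cast
            module
        · exact Or.inr (Or.inl ⟨i, hi', j, Finset.mem_erase.2 ⟨hjk, hj⟩, hij, h1⟩)
    · by_cases hik : i = k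
      · subst hik
        left
        rw [h1, hy,
          show ((M + 1 : ℕ) : F) • z - (c : F) • z = (((M + 1 : ℕ) : F) - c) • z by module,
          LinearMap.ker_smul]
        rw [sub_ne_zero]
        exact_mod_cast (by omega : M + 1 ≠ c)
      · exact Or.inr (Or.inr ⟨i, Finset.mem_erase.2 ⟨hik, hi⟩, c, by dsimp only; omega, h1⟩)
  · rintro (h1 | ⟨i, hi, j, hj, hij, h1⟩ | ⟨i, hi, c, hc, h1⟩)
    · exact Or.inl h1
    · exact Or.inr (Or.inl ⟨i, Finset.mem_of_mem_erase hi, j, Finset.mem_of_mem_erase hj, hij, h1⟩)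
    · obtain ⟨hik, hi⟩ := Finset.mem_erase.1 hi
      rcases (Nat.lt_succ_iff_lt_or_eq.1 hc : c < u i ∨ c = u i) with hc | rfl
      · exact Or.inr (Or.inr ⟨i, hi, c, hc, h1⟩)
      · right
        left
        rcases lt_or_gt_of_ne hik with h | h
        · refine ⟨i, hi, k, hk, h, Or.inl ?_⟩
          rw [h1, hlt i hi h, ← hy, ker_sub_comm]
        · refine ⟨k, hk, i, hi, h, Or.inr ?_⟩
          rw [h1, hgt i hi h, hy]
          congr 1
          push_cast
          module

/-- The hyperplanes `y_j = 0`, `j > k`, are redundant if `y_k = 0`. -/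
theorem shiHyps_of_eq_zero {z : Module.Dual F V} {y : ι → Module.Dual F V}
    {s : Finset ι} {u : ι → ℕ} {k : ι} (hk : k ∈ s) (hy : y k = 0)
    (hgt : ∀ j ∈ s, k < j → u j = 1) (hle : ∀ i ∈ s, i ≤ k → u i = 0) :
    shiHyps z y s u = shiHyps z y s 0 := by
  ext K
  constructor
  · rintro (h1 | h1 | ⟨i, hi, c, hc, h1⟩)
    · exact Or.inl h1
    · exact Or.inr (Or.inl h1)
    · rcases le_or_gt i k with h | h
      · rw [hle i hi h] at hc
        omega
      · rw [hgt i hi h] at hc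
        obtain rfl : c = 0 := by omega
        exact Or.inr (Or.inl ⟨k, hk, i, hi, h, Or.inl (by rw [h1, hy]; simp)⟩)
  · rintro (h1 | h1 | ⟨i, hi, c, hc, h1⟩)
    · exact Or.inl h1
    · exact Or.inr (Or.inl h1)
    · exact absurd hc (Nat.not_lt_zero _)

/-- The Shi arrangement as a pinned Shi arrangement. -/
theorem shiHyps_pin (z : Module.Dual F V) (y : ι → Module.Dual F V)
    {s : Finset ι} {m : ι} (hm : m ∈ s) (hmin : ∀ i ∈ s, m ≤ i) :
    shiHyps z y s 0 = shiHyps z (fun i => y i - y m) (s.erase m) (fun _ => 2) := by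
  ext K
  constructor
  · rintro (h1 | ⟨i, hi, j, hj, hij, h1⟩ | ⟨i, hi, c, hc, h1⟩)
    · exact Or.inl h1
    · have hj' : j ∈ s.erase m := Finset.mem_erase.2 ⟨((hmin i hi).trans_lt hij).ne', hj⟩
      by_cases him : i = m
      · subst him
        rcases h1 with h1 | h1
        · exact Or.inr (Or.inr ⟨j, hj', 0, two_pos, by rw [h1]; simp⟩)
        · exact Or.inr (Or.inr ⟨j, hj', 1, one_lt_two, by rw [h1]; simp⟩)
      · exact Or.inr (Or.inl ⟨i, Finset.mem_erase.2 ⟨him, hi⟩, j, hj', hij, by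
          simpa using h1⟩)
    · exact absurd hc (Nat.not_lt_zero _)
  · rintro (h1 | ⟨i, hi, j, hj, hij, h1⟩ | ⟨i, hi, c, hc, h1⟩)
    · exact Or.inl h1
    · exact Or.inr (Or.inl ⟨i, Finset.mem_of_mem_erase hi, j, Finset.mem_of_mem_erase hj, hij, by
        simpa using h1⟩)
    · obtain ⟨hne, hi⟩ := Finset.mem_erase.1 hi
      refine Or.inr (Or.inl ⟨m, hm, i, hi, lt_of_le_of_ne (hmin i hi) hne.symm, ?_⟩)
      rcases (by have : c < 2 := hc; omega : c = 0 ∨ c = 1) with rfl | rfl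
      · left; simpa using h1
      · right; simpa using h1

theorem AffIndep.pin {z : Module.Dual F V} {y : ι → Module.Dual F V} {s : Finset ι}
    (h : AffIndep z y s) {m : ι} (hm : m ∈ s) :
    Indep z (fun i => y i - y m) (s.erase m) := by
  intro a b
  obtain ⟨x, hx, hxs⟩ := h a (Function.update b m 0)
  refine ⟨x, hx, fun i hi => ?_⟩
  obtain ⟨hne, hi⟩ := Finset.mem_erase.1 hi
  have := hxs m hm i hi
  rwa [Function.update_self, Function.update_of_ne hne, sub_zero] at this

theorem Indep.restrict_erase {z : Module.Dual F V} {y : ι → Module.Dual F V} {s : Finset ι}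
    (h : Indep z y s) {k : ι} (hk : k ∈ s) {c : F} {H : Submodule F V}
    (hH : H = LinearMap.ker (y k - c • z)) :
    Indep (resDual H z) (fun i => resDual H (y i)) (s.erase k) := by
  intro a b
  obtain ⟨x, hx, hxs⟩ := h a (Function.update b k (c * a))
  have hxk := hxs k hk
  rw [Function.update_self] at hxk
  refine ⟨⟨x, by rw [hH]; simp [hx, hxk]⟩, hx, fun i hi => ?_⟩
  obtain ⟨hne, hi⟩ := Finset.mem_erase.1 hi
  have := hxs i hi
  rwa [Function.update_of_ne hne] at this

end ShiFamily

-- The induction that determines the exponents.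

universe w

theorem isGood_of_hyps_eq_empty {F : Type u} [Field F] {V : Type v} [AddCommGroup V]
    [Module F V] [FiniteDimensional F V] {A : LinArr F V} (hA : A.hyps = ∅) {d : ℕ}
    (hd : Module.finrank F V = d) : A.IsGood (Multiset.replicate d 0) := by
  subst hd
  have : A = empty F V := LinArr.ext hA
  rw [this]
  exact isGood_empty

theorem isGood_of_hyps_eq_singleton {F : Type u} [Field F] {V : Type v} [AddCommGroup V]
    [Module F V] [FiniteDimensional F V] {A : LinArr F V} {α : Module.Dual F V} (hα : α ≠ 0)
    (hA : A.hyps = {LinearMap.ker α}) {d : ℕ} (hd : Module.finrank F V = d + 1) :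
    A.IsGood (1 ::ₘ Multiset.replicate d 0) := by
  have hdel : (A.deletion (LinearMap.ker α)).hyps = ∅ := by
    change A.hyps \ _ = ∅
    rw [hA, sdiff_self]
    rfl
  refine IsGood.addition (H := LinearMap.ker α) (by rw [hA]; rfl) (b := 0) ?_ ?_
  · simpa [Multiset.replicate_succ] using isGood_of_hyps_eq_empty hdel hd
  · refine isGood_of_hyps_eq_empty ?_ (finrank_of_eq_ker hα rfl hd)
    rw [restriction_hyps rfl, hdel, Set.image_empty]

/-- The pinned Shi arrangements with `y_i ∈ {0, …, N}` for `i` in an upper set `t`, and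
`y_i ∈ {0, …, N - 1}` for the other `i`, have the expected exponents. -/
def PinnedGood (F : Type u) [Field F] (ι : Type w) [LinearOrder ι] (r N k : ℕ) : Prop :=
  ∀ (V : Type v) [AddCommGroup V] [Module F V] [FiniteDimensional F V] (z : Module.Dual F V)
    (y : ι → Module.Dual F V) (s t : Finset ι) (u : ι → ℕ) (q : ℕ) (A : LinArr F V),
    s.card = r → t ⊆ s → t.card = k → (∀ i ∈ t, ∀ j ∈ s, i < j → j ∈ t) →
    (∀ i ∈ s, u i = if i ∈ t then N + 1 else N) → Module.finrank F V = 1 + r + q →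
    Indep z y s → A.hyps = shiHyps z y s u →
    A.IsGood (1 ::ₘ (Multiset.replicate (r - k) (r - 1 + N) + Multiset.replicate k (r + N) +
      Multiset.replicate q 0))

/-- The Shi arrangements have the expected exponents. -/
def UnpinnedGood (F : Type u) [Field F] (ι : Type w) [LinearOrder ι] (r : ℕ) : Prop :=
  ∀ (V : Type v) [AddCommGroup V] [Module F V] [FiniteDimensional F V] (z : Module.Dual F V)
    (y : ι → Module.Dual F V) (s : Finset ι) (q : ℕ) (A : LinArr F V),
    s.card = r → Module.finrank F V = r + q →
    AffIndep z y s → A.hyps = shiHyps z y s 0 →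
    A.IsGood (1 ::ₘ (Multiset.replicate (r - 1) r + Multiset.replicate q 0))

variable {F : Type u} [Field F] {ι : Type w} [LinearOrder ι]

/-- Measured from the smallest vertex `m`, the hyperplanes `y_i - y_m ∈ {0, z}` are two pins on each
remaining vertex. -/
theorem unpinnedGood_of_pinnedGood {r : ℕ} (h : PinnedGood.{u, v, w} F ι r 2 0) :
    UnpinnedGood.{u, v, w} F ι (r + 1) := by
  intro V _ _ _ z y s q A hs hV hind hA
  have hne : s.Nonempty := Finset.card_pos.1 (by omega)
  have hm := s.min'_mem hne
  have hmin : ∀ i ∈ s, s.min' hne ≤ i := fun i hi => s.min'_le i hi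
  have := h V z (fun i => y i - y (s.min' hne)) (s.erase (s.min' hne)) ∅ (fun _ => 2) q A
    (by rw [Finset.card_erase_of_mem hm]; omega) (Finset.empty_subset _) rfl (by simp) (by simp)
    (by omega) (hind.pin hm) (by rw [hA, shiHyps_pin z y hm hmin])
  -- For `r = 0` the truncated `r - 1 + 2` is not `r + 1`, but that exponent has multiplicity zero.
  obtain rfl | hr := Nat.eq_zero_or_pos r
  · simpa using this
  · have h1 : r - 1 + 2 = r + 1 := by omega
    simpa [h1] using this

theorem pinnedGood_zero_zero (N : ℕ) : PinnedGood.{u, v, w} F ι 0 N 0 := by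
  intro V _ _ _ z y s t u q A hs _ _ _ _ hV hind hA
  obtain rfl := Finset.card_eq_zero.1 hs
  have hz : z ≠ 0 := by
    rintro rfl
    obtain ⟨x, hx, -⟩ := hind 1 0
    simp at hx
  have := isGood_of_hyps_eq_singleton hz (d := q) (by rw [hA]; ext; simp [shiHyps]) (by omega)
  simpa using this

section Steps

variable {s t : Finset ι} (ht : t.Nonempty)

theorem mem_of_min'_lt (hup : ∀ i ∈ t, ∀ j ∈ s, i < j → j ∈ t) {j : ι} (hj : j ∈ s)
    (h : t.min' ht < j) : j ∈ t.erase (t.min' ht) :=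
  Finset.mem_erase.2 ⟨h.ne', hup _ (t.min'_mem ht) j hj h⟩

theorem notMem_of_le_min' {i : ι} (h : i ≤ t.min' ht) : i ∉ t.erase (t.min' ht) := by
  intro hi
  obtain ⟨hne, hi⟩ := Finset.mem_erase.1 hi
  exact hne (le_antisymm h (t.min'_le i hi))

theorem upper_erase_min' (hup : ∀ i ∈ t, ∀ j ∈ s, i < j → j ∈ t) :
    ∀ i ∈ t.erase (t.min' ht), ∀ j ∈ s, i < j → j ∈ t.erase (t.min' ht) := by
  intro i hi j hj hij
  exact mem_of_min'_lt ht hup hj ((t.min'_le i (Finset.mem_of_mem_erase hi)).trans_lt hij)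

end Steps

/-- The two descriptions agree: all vertices have `N + 1` pins. -/
theorem pinnedGood_succ_zero {r N : ℕ}
    (h : PinnedGood.{u, v, w} F ι (r + 1) N (r + 1)) :
    PinnedGood.{u, v, w} F ι (r + 1) (N + 1) 0 := by
  intro V _ _ _ z y s t u q A hs hts ht _ hu hV hind hA
  obtain rfl := Finset.card_eq_zero.1 ht
  have := h V z y s s u q A hs subset_rfl hs
    (fun _ _ _ hj _ => hj) (fun i hi => by simp [hu i hi, hi]) hV hind hA
  convert this using 2
  have h1 : r + (N + 1) = r + 1 + N := by omega
  simp [h1]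

variable [CharZero F]

/-- Pinning one vertex after the other at `0`. -/
theorem isGood_partially_pinned {r : ℕ} (h : UnpinnedGood.{u, v, w} F ι (r + 1)) (k : ℕ)
    (V : Type v) [AddCommGroup V] [Module F V] [FiniteDimensional F V]
    (z : Module.Dual F V) (y : ι → Module.Dual F V) (s : Finset ι) (q : ℕ)
    (hs : s.card = r + 1) (hV : Module.finrank F V = 1 + (r + 1) + q) (hind : Indep z y s) :
    ∀ (t : Finset ι) (u : ι → ℕ) (A : LinArr F V), t ⊆ s → t.card = k →
    (∀ i ∈ t, ∀ j ∈ s, i < j → j ∈ t) → (∀ i ∈ s, u i = if i ∈ t then 1 else 0) →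
    A.hyps = shiHyps z y s u →
    A.IsGood (k ::ₘ 1 ::ₘ (Multiset.replicate r (r + 1) + Multiset.replicate q 0)) := by
  induction k with
  | zero =>
    intro t u A hts ht _ hu hA
    obtain rfl := Finset.card_eq_zero.1 ht
    -- Without pins only `z` and the differences occur, so one more dimension is free. It provides
    -- the exponent `0` that each new pin raises by one.
    have := h V z y s (q + 1) A hs (by omega) hind.affIndep
      (by rw [hA]; exact shiHyps_congr fun i hi => by simp [hu i hi])
    convert this using 1
    rw [Multiset.cons_swap, Multiset.replicate_succ, Multiset.add_cons]
    rfl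
  | succ k ih =>
    intro t u A hts ht hup hu hA
    have htn : t.Nonempty := Finset.card_pos.1 (by omega)
    set m := t.min' htn with hm
    have hmt : m ∈ t := t.min'_mem htn
    have hms : m ∈ s := hts hmt
    have hu' : ∀ i ∈ s, Function.update u m 0 i = if i ∈ t.erase m then 1 else 0 := by
      intro i hi
      by_cases him : i = m
      · simp [him]
      · rw [Function.update_of_ne him, hu i hi]
        simp [him]
    obtain ⟨hmem, hdel⟩ := shiHyps_deletion hind (u := Function.update u m 0) (u' := u) hms
      (N := 0) (by simp) (by simp [hu m hms, hmt])
      (fun i hi => (Function.update_of_ne hi _ _).symm) hA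
    set H := LinearMap.ker (y m - ((0 : ℕ) : F) • z) with hH
    refine IsGood.addition hmem (ih (t.erase m) _ _ ((Finset.erase_subset _ _).trans hts)
      (by rw [Finset.card_erase_of_mem hmt]; omega) (upper_erase_min' htn hup) hu' hdel) ?_
    rw [Nat.cast_zero] at hH
    -- On `y_m = 0` the pins above `m` coincide with `y_j - y_m = 0`. Hence the restriction is an
    -- unpinned Shi arrangement on all of `s`, with the same exponents at every stage.
    have h1 := h H (resDual H z) (fun i => resDual H (y i)) s q (A.restriction H) hs
      (finrank_of_eq_ker (hind.sub_smul_ne_zero hms 0) hH (by omega))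
      (hind.restrict_affIndep hms hH) (by
        rw [restriction_hyps hH, hdel, image_comap_shiHyps]
        refine shiHyps_of_eq_zero hms (by rw [resDual_eq_smul hH, zero_smul]) ?_ ?_
        · intro j hj hmj
          rw [hu' j hj, if_pos (mem_of_min'_lt htn hup hj hmj)]
        · intro i hi him
          rw [hu' i hi, if_neg (notMem_of_le_min' htn him)])
    exact h1

/-- After all `r + 1` pins the exponent that started at `0` equals `r + 1`, like the other `r`. -/
theorem pinnedGood_one_zero {r : ℕ} (h : UnpinnedGood.{u, v, w} F ι (r + 1)) :
    PinnedGood.{u, v, w} F ι (r + 1) 1 0 := by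
  intro V _ _ _ z y s t u q A hs hts ht _ hu hV hind hA
  obtain rfl := Finset.card_eq_zero.1 ht
  have := isGood_partially_pinned h (r + 1) V z y s q hs hV hind s u A subset_rfl hs
    (fun _ _ _ hj _ => hj) (fun i hi => by simp [hu i hi, hi]) hA
  convert this using 1
  rw [Multiset.cons_swap]
  simp [Multiset.replicate_succ]

/-- The pin `y_m = N z` is removed for the smallest `m ∈ t`. The deletion has `r - k + 1` exponents
`r + N`; the restriction, with parameters `r`, `N + 1`, `k`, lacks one of them, and this one becomes
`r + 1 + N`. -/
theorem pinnedGood_succ {r N k : ℕ} (hN : 1 ≤ N) (h₁ : PinnedGood.{u, v, w} F ι (r + 1) N k)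
    (h₂ : PinnedGood.{u, v, w} F ι r (N + 1) k) :
    PinnedGood.{u, v, w} F ι (r + 1) N (k + 1) := by
  intro V _ _ _ z y s t u q A hs hts ht hup hu hV hind hA
  have htn : t.Nonempty := Finset.card_pos.1 (by omega)
  have hkr : k + 1 ≤ r + 1 := by
    rw [← hs, ← ht]
    exact Finset.card_le_card hts
  set m := t.min' htn with hm
  have hmt : m ∈ t := t.min'_mem htn
  have hms : m ∈ s := hts hmt
  have hu' : ∀ i ∈ s, Function.update u m N i = if i ∈ t.erase m then N + 1 else N := by
    intro i hi
    by_cases him : i = m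
    · simp [him]
    · rw [Function.update_of_ne him, hu i hi]
      simp [him]
  obtain ⟨hmem, hdel⟩ := shiHyps_deletion hind (u := Function.update u m N) (u' := u) hms
    (N := N) (by simp) (by simp [hu m hms, hmt])
    (fun i hi => (Function.update_of_ne hi _ _).symm) hA
  set H := LinearMap.ker (y m - (N : F) • z) with hH
  have hcard : (t.erase m).card = k := by
    rw [Finset.card_erase_of_mem hmt]
    omega
  have hgood₁ := h₁ V z y s (t.erase m) _ q _ hs ((Finset.erase_subset _ _).trans hts) hcard
    (upper_erase_min' htn hup) hu' hV hind hdel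
  have hgood₂ := h₂ H (resDual H z) (fun i => resDual H (y i)) (s.erase m) (t.erase m)
    (fun i => Function.update u m N i + 1) q (A.restriction H)
    (by rw [Finset.card_erase_of_mem hms]; omega) (Finset.erase_subset_erase _ hts) hcard
    (fun i hi j hj => upper_erase_min' htn hup i hi j (Finset.mem_of_mem_erase hj))
    (fun i hi => by
      rw [hu' i (Finset.mem_of_mem_erase hi)]
      split_ifs <;> rfl)
    (finrank_of_eq_ker (hind.sub_smul_ne_zero hms N) hH (by omega))
    (hind.restrict_erase hms hH) (by
      rw [restriction_hyps hH, hdel, image_comap_shiHyps]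
      refine shiHyps_erase hms hN (resDual_eq_smul hH) (by simp) ?_ ?_
      · intro j hj hmj
        rw [hu' j hj, if_pos (mem_of_min'_lt htn hup hj hmj)]
      · intro i hi him
        rw [hu' i hi, if_neg (notMem_of_le_min' htn him.le)])
  have hgood := IsGood.addition hmem (b := r + N) (e := 1 ::ₘ (Multiset.replicate (r - k) (r + N) +
    Multiset.replicate k (r + 1 + N) + Multiset.replicate q 0)) ?_ ?_
  · convert hgood using 1
    rw [Multiset.cons_swap, Multiset.replicate_succ, Multiset.add_cons, Multiset.cons_add]
    have e1 : r + 1 - (k + 1) = r - k := by omega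
    have e2 : r + N + 1 = r + 1 + N := by omega
    simp [e1, e2]
  · convert hgood₁ using 1
    have e1 : r + 1 - k = r - k + 1 := by omega
    rw [Multiset.cons_swap, e1, Multiset.replicate_succ, Multiset.cons_add, Multiset.cons_add]
    simp
  · convert hgood₂ using 1
    rcases Nat.eq_zero_or_pos r with rfl | hr
    · obtain rfl : k = 0 := by omega
      simp
    · have e1 : r - 1 + (N + 1) = r + N := by omega
      have e2 : r + (N + 1) = r + 1 + N := by omega
      rw [e1, e2]

/-- Nested induction on `r`, `N`, `k`. The case `N = 1`, `k = 0` goes through the Shi arrangement on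
`r + 1` vertices, hence uses `N = 2` on `r` vertices; so the hypothesis for `r` is needed for all
`N` and `k`. -/
theorem pinnedGood (r : ℕ) : ∀ N k, 1 ≤ N → PinnedGood.{u, v, w} F ι r N k := by
  induction r with
  | zero =>
    intro N k hN
    rcases Nat.eq_zero_or_pos k with rfl | hk
    · exact pinnedGood_zero_zero N
    · intro V _ _ _ z y s t u q A hs hts ht
      have := Finset.card_le_card hts
      omega
  | succ r ih =>
    intro N k hN
    induction N, hN using Nat.le_induction generalizing k with
    | base =>
      induction k with
      | zero => exact pinnedGood_one_zero (unpinnedGood_of_pinnedGood (ih 2 0 one_le_two))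
      | succ k ihk => exact pinnedGood_succ le_rfl ihk (ih _ _ (by omega))
    | succ N hN ihN =>
      induction k with
      | zero => exact pinnedGood_succ_zero (ihN _)
      | succ k ihk => exact pinnedGood_succ (by omega) ihk (ih _ _ (by omega))

end LinArr

/-! ### Whitney's formula and uniqueness of the characteristic polynomial. -/

theorem sum_powerset_insert_neg {γ R : Type*} [DecidableEq γ] [CommRing R] (t : Finset γ) (c : γ)
    (ψ : Finset γ → R) (hc : c ∉ t) :
    ∑ B ∈ (insert c t).powerset, (-1) ^ B.card * ψ B =
      ∑ B ∈ t.powerset, (-1) ^ B.card * (ψ B - ψ (insert c B)) := by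
  rw [Finset.sum_powerset_insert hc, ← Finset.sum_add_distrib]
  refine Finset.sum_congr rfl fun B hB => ?_
  rw [Finset.card_insert_of_notMem fun h => hc (Finset.mem_powerset.1 hB h), pow_succ]
  ring

/-- Inclusion-exclusion over the subsets of `s` depends only on the image of `s`. -/
theorem sum_powerset_image {α β R : Type*} [DecidableEq α] [DecidableEq β] [CommRing R]
    (g : α → β) (s : Finset α) (φ : Finset β → R) :
    ∑ B ∈ s.powerset, (-1) ^ B.card * φ (B.image g) =
      ∑ C ∈ (s.image g).powerset, (-1) ^ C.card * φ C := by
  induction s using Finset.induction_on generalizing φ with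
  | empty => simp
  | insert a s ha ih =>
    have h1 := sum_powerset_insert_neg s a (fun B => φ (B.image g)) ha
    simp only [Finset.image_insert] at h1 ⊢
    rw [h1, ih fun C => φ C - φ (insert (g a) C)]
    by_cases hg : g a ∈ s.image g
    · rw [Finset.insert_eq_of_mem hg]
      -- If `g a` is already in the image, the sets `C` with and without `g a` cancel in pairs.
      have h2 : ∑ C ∈ (s.image g).powerset, (-1) ^ C.card * φ (insert (g a) C) = 0 := by
        rw [← Finset.insert_erase hg, sum_powerset_insert_neg _ _ (fun C => φ (insert (g a) C))
          (Finset.notMem_erase _ _)]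
        exact Finset.sum_eq_zero fun C _ => by simp
      simp only [mul_sub, Finset.sum_sub_distrib]
      rw [h2, sub_zero]
    · rw [sum_powerset_insert_neg _ _ φ hg]

namespace LinArr

section Whitney

open Polynomial

variable {F V : Type*} [Field F] [AddCommGroup V] [Module F V]

/-- Whitney's expression for the characteristic polynomial. -/
def whitney (A : LinArr F V) : ℤ[X] :=
  ∑ B ∈ A.finite.toFinset.powerset,
    (-1) ^ B.card * X ^ Module.finrank F (B.inf id : Submodule F V)

/-- Subsets containing `H` are `B ∪ {H}` with `B ⊆ A'`, with reversed sign, and their intersection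
is that of the traces on `H`. Several members of `A'` may have the same trace, but by
`sum_powerset_image` the alternating sum does not see this. -/
theorem whitney_deletion_restriction (A : LinArr F V) {H : Submodule F V} (hH : H ∈ A.hyps) :
    A.whitney = (A.deletion H).whitney - (A.restriction H).whitney := by
  classical
  obtain ⟨α, hα, hHα⟩ := A.isHyperplane H hH
  set s := (A.deletion H).finite.toFinset with hs
  have h1 : A.finite.toFinset = insert H s := by
    ext K
    simp only [Set.Finite.mem_toFinset, Finset.mem_insert, hs]
    constructor
    · intro hK
      by_cases h : K = H
      · exact Or.inl h
      · exact Or.inr ⟨hK, h⟩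
    · rintro (rfl | h)
      · exact hH
      · exact h.1
  have h2 : (A.restriction H).finite.toFinset = s.image fun K => K.comap H.subtype := by
    ext K
    simp only [Set.Finite.mem_toFinset, restriction_hyps hHα, Finset.mem_image, Set.mem_image, hs]
  have hHs : H ∉ s := by
    simp only [hs, Set.Finite.mem_toFinset]
    exact fun h => h.2 rfl
  have h3 : ∀ B : Finset (Submodule F V),
      Module.finrank F ((B.image fun K => K.comap H.subtype).inf id : Submodule F H) =
        Module.finrank F ((insert H B).inf id : Submodule F V) := by
    intro B
    have h4 : ((B.image fun K => K.comap H.subtype).inf id : Submodule F H) =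
        (B.inf id).comap H.subtype := by
      ext x
      simp [Submodule.mem_finsetInf]
    rw [h4, Finset.inf_insert, id, ← Submodule.map_comap_subtype,
      Submodule.finrank_map_subtype_eq]
  rw [whitney, whitney, whitney, h1, h2, ← sum_powerset_image, Finset.sum_powerset_insert hHs,
    sub_eq_add_neg, ← Finset.sum_neg_distrib]
  congr 1
  refine Finset.sum_congr rfl fun B hB => ?_
  rw [Finset.card_insert_of_notMem fun h => hHs (Finset.mem_powerset.1 hB h), h3, pow_succ]
  ring

end Whitney

universe u v

theorem IsCharPoly.eq_whitney {F : Type u} [Field F] {V : Type v} [AddCommGroup V] [Module F V]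
    {A : LinArr F V} {p : Polynomial ℤ} (h : A.IsCharPoly p) : p = A.whitney := by
  induction h with
  | empty V =>
    have h1 : (LinArr.empty F V).finite.toFinset = ∅ := by
      rw [Set.Finite.toFinset_eq_empty]
      rfl
    rw [whitney, h1, Finset.powerset_empty, Finset.sum_singleton, Finset.inf_empty, finrank_top]
    simp
  | step A H hH p' p'' _ _ h1 h2 => rw [whitney_deletion_restriction A hH, h1, h2]

/-- The characteristic polynomial does not depend on the choices in its recursion. -/
theorem IsCharPoly.unique {F : Type u} [Field F] {V : Type v} [AddCommGroup V] [Module F V]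
    {A : LinArr F V} {p q : Polynomial ℤ} (hp : A.IsCharPoly p) (hq : A.IsCharPoly q) : p = q :=
  hp.eq_whitney.trans hq.eq_whitney.symm

end LinArr

/-! ### Zaslavsky's theorem for sign patterns. -/

/-- Equal fibres on `S` mean equally many values. This compares the sign patterns of different
arrangements on a common set of points. -/
theorem encard_image_eq_of_iff {X Y Z : Type*} (f : X → Y) (g : X → Z) (S : Set X)
    (h : ∀ x ∈ S, ∀ y ∈ S, f x = f y ↔ g x = g y) : (f '' S).encard = (g '' S).encard := by
  rcases S.eq_empty_or_nonempty with rfl | ⟨x₀, hx₀⟩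
  · simp
  have : Nonempty X := ⟨x₀⟩
  have hinv : ∀ x ∈ S, Function.invFunOn g S (g x) ∈ S ∧ g (Function.invFunOn g S (g x)) = g x :=
    fun x hx => ⟨Function.invFunOn_mem ⟨x, hx, rfl⟩, Function.invFunOn_eq ⟨x, hx, rfl⟩⟩
  have hk : ∀ x ∈ S, f (Function.invFunOn g S (g x)) = f x := fun x hx =>
    (h _ (hinv x hx).1 _ hx).2 (hinv x hx).2
  have h1 : f '' S = (fun t => f (Function.invFunOn g S t)) '' (g '' S) := by
    rw [Set.image_image]
    exact Set.image_congr fun x hx => (hk x hx).symm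
  rw [h1]
  apply Set.InjOn.encard_image
  rintro _ ⟨x, hx, rfl⟩ _ ⟨y, hy, rfl⟩ hxy
  dsimp only at hxy
  rw [hk x hx, hk y hy] at hxy
  exact (h x hx y hy).1 hxy

namespace LinArr

section Regions

variable {V : Type*} [AddCommGroup V] [Module ℝ V]

/-- The complement of a real arrangement. -/
def compl (A : LinArr ℝ V) : Set V := {x | ∀ H ∈ A.hyps, x ∉ H}

/-- The set of forms of the arrangement that are positive at `x`. -/
def pattern (A : LinArr ℝ V) (x : V) : Set (Module.Dual ℝ V) :=
  {α | LinearMap.ker α ∈ A.hyps ∧ 0 < α x}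

/-- No hyperplane of the arrangement separates `x` and `y`. -/
def SameSide (A : LinArr ℝ V) (x y : V) : Prop :=
  ∀ α : Module.Dual ℝ V, LinearMap.ker α ∈ A.hyps → 0 < α x * α y

theorem mem_compl_iff {A : LinArr ℝ V} {x : V} :
    x ∈ A.compl ↔ ∀ α : Module.Dual ℝ V, LinearMap.ker α ∈ A.hyps → α x ≠ 0 := by
  constructor
  · intro h α hα
    exact h _ hα
  · intro h H hH
    obtain ⟨α, -, rfl⟩ := A.isHyperplane H hH
    exact h α hH

theorem SameSide.left {A : LinArr ℝ V} {x y : V} (h : A.SameSide x y) : x ∈ A.compl :=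
  mem_compl_iff.2 fun α hα h0 => by simpa [h0] using h α hα

theorem SameSide.symm {A : LinArr ℝ V} {x y : V} (h : A.SameSide x y) : A.SameSide y x :=
  fun α hα => mul_comm (α x) (α y) ▸ h α hα

/-- A hyperplane has both `α` and `-α` as forms, so the positive forms at a point also record the
negative ones. -/
theorem pattern_eq_iff {A : LinArr ℝ V} {x y : V} (hx : x ∈ A.compl) :
    A.pattern x = A.pattern y ↔ A.SameSide x y := by
  rw [mem_compl_iff] at hx
  constructor
  · intro h α hα
    have key : ∀ β : Module.Dual ℝ V, LinearMap.ker β ∈ A.hyps → (0 < β x ↔ 0 < β y) := by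
      intro β hβ
      have : β ∈ A.pattern x ↔ β ∈ A.pattern y := by rw [h]
      simpa [pattern, hβ] using this
    have h1 := key α hα
    have h2 := key (-α) (by rwa [LinearMap.ker_neg])
    simp only [LinearMap.neg_apply, neg_pos] at h2
    rcases lt_or_gt_of_ne (hx α hα) with h | h
    · exact mul_pos_of_neg_of_neg h (h2.1 h)
    · exact mul_pos h (h1.1 h)
  · intro h
    ext α
    refine and_congr_right fun hα => ?_
    have := h α hα
    exact pos_iff_pos_of_mul_pos this

/-- It suffices to test one form for each hyperplane. -/
theorem sameSide_of_forall_exists {A : LinArr ℝ V} {x y : V}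
    (h : ∀ H ∈ A.hyps, ∃ α : Module.Dual ℝ V, H = LinearMap.ker α ∧ 0 < α x * α y) :
    A.SameSide x y := by
  intro β hβ
  obtain ⟨α, hα, hpos⟩ := h _ hβ
  obtain ⟨c, rfl⟩ := exists_smul_of_ker_le hα.ge
  have hc : c ≠ 0 := by
    rintro rfl
    exact ne_zero_of_ker_mem hβ (zero_smul _ _)
  have : (c • α) x * (c • α) y = (c * c) * (α x * α y) := by
    simp only [LinearMap.smul_apply, smul_eq_mul]
    ring
  rw [this]
  exact mul_pos (mul_self_pos.2 hc) hpos

theorem exists_perturbation {A : LinArr ℝ V} {x : V} (hx : x ∈ A.compl) (v : V) :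
    ∃ ε : ℝ, 0 < ε ∧ A.SameSide x (x + ε • v) := by
  have h1 : ∀ H ∈ A.hyps, ∀ᶠ ε in nhdsWithin (0 : ℝ) (Set.Ioi 0),
      ∃ α : Module.Dual ℝ V, H = LinearMap.ker α ∧ 0 < α x * α (x + ε • v) := by
    intro H hH
    obtain ⟨α, -, rfl⟩ := A.isHyperplane H hH
    have hαx := mem_compl_iff.1 hx α hH
    have hcont : Continuous fun ε : ℝ => α x * (α x + ε * α v) := by fun_prop
    have h2 : ∀ᶠ ε in nhds (0 : ℝ), 0 < α x * (α x + ε * α v) :=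
      hcont.continuousAt.eventually_const_lt (by simpa using mul_self_pos.2 hαx)
    filter_upwards [h2.filter_mono nhdsWithin_le_nhds] with ε hε
    exact ⟨α, rfl, by simpa using hε⟩
  have h3 := (A.finite.eventually_all).2 h1
  obtain ⟨ε, hε, hε0⟩ := (h3.and self_mem_nhdsWithin).exists
  exact ⟨ε, hε0, sameSide_of_forall_exists hε⟩

/-- The number of regions of a real arrangement, as the number of sign patterns. -/
def numRegions (A : LinArr ℝ V) : ℕ∞ := (A.pattern '' A.compl).encard

/-- The patterns of `A` are counted separately on the two sides of `H`. A pattern of `A'` is counted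
twice exactly if it occurs on both sides, and this means that it occurs on `H`, where it is a
pattern of `A''`. -/
theorem numRegions_deletion_restriction (A : LinArr ℝ V) {H : Submodule ℝ V} (hH : H ∈ A.hyps) :
    A.numRegions = (A.deletion H).numRegions + (A.restriction H).numRegions := by
  obtain ⟨α, hα, hHα⟩ := A.isHyperplane H hH
  have hαA : LinearMap.ker α ∈ A.hyps := hHα ▸ hH
  obtain ⟨v, hv⟩ := LinearMap.surjective hα 1
  set A' := A.deletion H with hA'
  have hsub : ∀ x ∈ A.compl, x ∈ A'.compl := fun x hx K hK => hx K hK.1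
  have hside : ∀ x y, A.SameSide x y → A'.SameSide x y := fun x y h β hβ => h β hβ.1
  have hside' : ∀ x y, 0 < α x * α y → A'.SameSide x y → A.SameSide x y := by
    intro x y hpos h
    refine sameSide_of_forall_exists fun K hK => ?_
    by_cases hKH : K = H
    · exact ⟨α, hKH.trans hHα, hpos⟩
    · obtain ⟨β, -, rfl⟩ := A.isHyperplane K hK
      exact ⟨β, rfl, h β ⟨hK, hKH⟩⟩
  have hcompl : ∀ x, x ∈ A.compl ↔ x ∈ A'.compl ∧ α x ≠ 0 := by
    intro x
    refine ⟨fun hx => ⟨hsub x hx, mem_compl_iff.1 hx α hαA⟩, fun ⟨h1, h2⟩ K hK => ?_⟩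
    by_cases hKH : K = H
    · rw [hKH, hHα]
      exact h2
    · exact h1 K ⟨hK, hKH⟩
  set U₁ := {x ∈ A'.compl | 0 < α x} with hU₁
  set U₂ := {x ∈ A'.compl | α x < 0} with hU₂
  set U₀ := {x ∈ A'.compl | α x = 0} with hU₀
  have hU : A.compl = U₁ ∪ U₂ := by
    ext x
    rw [hcompl, Set.mem_union, hU₁, hU₂, Set.mem_ofPred_eq, Set.mem_ofPred_eq, ← and_or_left,
      ne_iff_lt_or_gt, or_comm]
  have hdisj : Disjoint (A.pattern '' U₁) (A.pattern '' U₂) := by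
    rw [Set.disjoint_left]
    rintro _ ⟨x, hx, rfl⟩ ⟨y, hy, hxy⟩
    have : α ∈ A.pattern x := ⟨hαA, hx.2⟩
    rw [← hxy] at this
    exact absurd this.2 (not_lt.2 hy.2.le)
  have h₁ : (A.pattern '' U₁).encard = (A'.pattern '' U₁).encard := by
    refine encard_image_eq_of_iff _ _ _ fun x hx y hy => ?_
    rw [pattern_eq_iff ((hcompl x).2 ⟨hx.1, hx.2.ne'⟩),
      pattern_eq_iff hx.1]
    exact ⟨hside x y, hside' x y (mul_pos hx.2 hy.2)⟩
  have h₂ : (A.pattern '' U₂).encard = (A'.pattern '' U₂).encard := by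
    refine encard_image_eq_of_iff _ _ _ fun x hx y hy => ?_
    rw [pattern_eq_iff ((hcompl x).2 ⟨hx.1, hx.2.ne⟩),
      pattern_eq_iff hx.1]
    exact ⟨hside x y, hside' x y (mul_pos_of_neg_of_neg hx.2 hy.2)⟩
  -- A small move off `H` in direction `± v`, where `α v = 1`, keeps the pattern for `A'`.
  have hpert : ∀ x ∈ U₀, ∀ c : ℝ, ∃ y ∈ A'.compl, A'.pattern y = A'.pattern x ∧
      ∃ ε : ℝ, 0 < ε ∧ α y = ε * c := by
    intro x hx c
    obtain ⟨ε, hε, h⟩ := exists_perturbation hx.1 (c • v)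
    refine ⟨_, h.symm.left, (pattern_eq_iff h.symm.left).2 h.symm, ε, hε, ?_⟩
    simp [hx.2, hv]
  have hpos : ∀ x ∈ U₀, A'.pattern x ∈ A'.pattern '' U₁ := by
    intro x hx
    obtain ⟨y, hy, hyx, ε, hε, h⟩ := hpert x hx 1
    exact ⟨y, ⟨hy, by rw [h, mul_one]; exact hε⟩, hyx⟩
  have hneg : ∀ x ∈ U₀, A'.pattern x ∈ A'.pattern '' U₂ := by
    intro x hx
    obtain ⟨y, hy, hyx, ε, hε, h⟩ := hpert x hx (-1)
    exact ⟨y, ⟨hy, by rw [h]; linarith⟩, hyx⟩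
  have hunion : A'.pattern '' U₁ ∪ A'.pattern '' U₂ = A'.pattern '' A'.compl := by
    apply Set.Subset.antisymm
    · rintro _ (⟨x, hx, rfl⟩ | ⟨x, hx, rfl⟩)
      · exact ⟨x, hx.1, rfl⟩
      · exact ⟨x, hx.1, rfl⟩
    · rintro _ ⟨x, hx, rfl⟩
      rcases lt_trichotomy (α x) 0 with h | h | h
      · exact Or.inr ⟨x, ⟨hx, h⟩, rfl⟩
      · exact Or.inl (hpos x ⟨hx, h⟩)
      · exact Or.inl ⟨x, ⟨hx, h⟩, rfl⟩
  have hinter : A'.pattern '' U₁ ∩ A'.pattern '' U₂ = A'.pattern '' U₀ := by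
    apply Set.Subset.antisymm
    · rintro _ ⟨⟨x, hx, rfl⟩, ⟨y, hy, hxy⟩⟩
      have hs := (pattern_eq_iff hy.1).1 hxy
      -- A positive multiple of the point where the segment from `y` to `x` crosses `H`; as a
      -- positive combination it stays on the common side of all members of `A'`.
      have hs' : A'.SameSide ((α x) • y + (-α y) • x) x := by
        intro β hβ
        have h1 := hs β hβ
        have h2 : 0 < β x * β x := mul_self_pos.2 (mem_compl_iff.1 hx.1 β hβ)
        have h3 := hx.2
        have h4 : 0 < -α y := neg_pos.2 hy.2
        have h5 : β ((α x) • y + (-α y) • x) * β x =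
            α x * (β y * β x) + (-α y) * (β x * β x) := by
          simp only [map_add, map_smul, smul_eq_mul]
          ring
        rw [h5]
        positivity
      refine ⟨_, ⟨hs'.left, ?_⟩, (pattern_eq_iff hs'.left).2 hs'⟩
      simp only [map_add, map_smul, smul_eq_mul]
      ring
    · rintro _ ⟨x, hx, rfl⟩
      exact ⟨hpos x hx, hneg x hx⟩
  have hcompl'' : U₀ = (Subtype.val : H → V) '' (A.restriction H).compl := by
    ext x
    constructor
    · rintro ⟨hx, h0⟩
      refine ⟨⟨x, by rw [hHα]; exact h0⟩, ?_, rfl⟩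
      rintro _ ⟨K, hK, hHK, rfl⟩ hxK
      exact hx K ⟨hK, fun h => hHK (Set.mem_singleton_iff.1 h).ge⟩ hxK
    · rintro ⟨x, hx, rfl⟩
      refine ⟨fun K hK hxK => ?_, ?_⟩
      · exact hx _ (deletion_comap_mem_restriction hHα hK) hxK
      · exact hHα.le x.2
  have hres : (A'.pattern '' U₀).encard = (A.restriction H).numRegions := by
    rw [hcompl'', Set.image_image, numRegions]
    refine encard_image_eq_of_iff _ _ _ fun x hx y hy => ?_
    have hx' : (x : V) ∈ U₀ := hcompl''.symm ▸ ⟨x, hx, rfl⟩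
    have hy' : (y : V) ∈ U₀ := hcompl''.symm ▸ ⟨y, hy, rfl⟩
    rw [pattern_eq_iff hx, pattern_eq_iff hx'.1]
    constructor
    · intro h γ hγ
      obtain ⟨κ, hκ, hHκ, rfl⟩ := exists_form_of_mem_restriction hγ
      exact h κ ⟨hκ, fun h => hHκ (Set.mem_singleton_iff.1 h).ge⟩
    · intro h β hβ
      refine h (resDual H β) ?_
      rw [ker_resDual]
      exact deletion_comap_mem_restriction hHα hβ
  rw [numRegions, hU, Set.image_union, Set.encard_union_eq hdisj, h₁, h₂,
    ← Set.encard_union_add_encard_inter, hunion, hinter, hres]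
  rfl

end Regions

universe v

/-- Zaslavsky's theorem. -/
theorem IsCharPoly.numRegions {V : Type v} [AddCommGroup V] [Module ℝ V] {A : LinArr ℝ V}
    {p : Polynomial ℤ} (h : A.IsCharPoly p) :
    FiniteDimensional ℝ V ∧ ∃ m : ℕ, A.numRegions = m ∧
      (m : ℤ) = (-1) ^ Module.finrank ℝ V * p.eval (-1) := by
  induction h with
  | empty V =>
    refine ⟨inferInstance, 1, ?_, ?_⟩
    · have h1 : (LinArr.empty ℝ V).pattern = fun _ => ∅ := by
        ext x α
        simp [pattern, LinArr.empty]
      have h2 : (LinArr.empty ℝ V).compl = Set.univ := by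
        ext x
        simp [compl, LinArr.empty]
      rw [LinArr.numRegions, h1, h2, Set.image_univ, Set.range_const, Set.encard_singleton,
        Nat.cast_one]
    · rw [Polynomial.eval_pow, Polynomial.eval_X, ← mul_pow]
      simp
  | step A H hH p' p'' _ _ h1 h2 =>
    obtain ⟨hfin, m', hm', hm'p⟩ := h1
    obtain ⟨-, m'', hm'', hm''p⟩ := h2
    obtain ⟨α, hα, hHα⟩ := A.isHyperplane H hH
    refine ⟨hfin, m' + m'', ?_, ?_⟩
    · rw [numRegions_deletion_restriction A hH, hm', hm'', Nat.cast_add]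
    -- The restriction lives in one dimension less, so the sign `(-1) ^ dim` turns the difference of
    -- polynomials into the sum of counts.
    · have hV := Module.Dual.finrank_ker_add_one_of_ne_zero hα
      rw [← hHα] at hV
      rw [← hV] at hm'p ⊢
      rw [Nat.cast_add, hm'p, hm''p, Polynomial.eval_sub]
      ring

/-! ### Chambers as connected components. -/

section Topology

variable {V : Type*} [AddCommGroup V] [Module ℝ V] [TopologicalSpace V] [IsTopologicalAddGroup V]
  [ContinuousSMul ℝ V] [T2Space V] [FiniteDimensional ℝ V]

/-- Off the hyperplanes the condition `0 < α x * α w` on `w` is clopen, so a component cannot change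
sides. Conversely, the segment between two points on the same side of every hyperplane avoids the
arrangement. -/
theorem connectedComponent_eq_iff (A : LinArr ℝ V) (x y : {x : V // ∀ H ∈ A.hyps, x ∉ H}) :
    connectedComponent x = connectedComponent y ↔ A.pattern x = A.pattern y := by
  constructor
  · intro h
    rw [pattern_eq_iff x.2]
    intro α hα
    have hcont : Continuous fun w : {x : V // ∀ H ∈ A.hyps, x ∉ H} => α x * α w :=
      continuous_const.mul (α.continuous_of_finiteDimensional.comp continuous_subtype_val)
    have hne : ∀ w : {x : V // ∀ H ∈ A.hyps, x ∉ H}, α x * α w ≠ 0 := fun w =>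
      mul_ne_zero (mem_compl_iff.1 x.2 α hα) (mem_compl_iff.1 w.2 α hα)
    have hclopen : IsClopen {w : {x : V // ∀ H ∈ A.hyps, x ∉ H} | 0 < α x * α w} := by
      refine ⟨?_, isOpen_lt continuous_const hcont⟩
      have : {w : {x : V // ∀ H ∈ A.hyps, x ∉ H} | 0 < α x * α w} =
          {w : {x : V // ∀ H ∈ A.hyps, x ∉ H} | 0 ≤ α x * α w} := by
        ext w
        simp only [Set.mem_ofPred_eq]
        exact ⟨le_of_lt, fun h => lt_of_le_of_ne h (hne w).symm⟩
      rw [this]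
      exact isClosed_le continuous_const hcont
    have hx : x ∈ {w : {x : V // ∀ H ∈ A.hyps, x ∉ H} | 0 < α x * α w} :=
      mul_self_pos.2 (mem_compl_iff.1 x.2 α hα)
    exact hclopen.connectedComponent_subset hx (h ▸ mem_connectedComponent)
  · intro h
    rw [pattern_eq_iff x.2] at h
    have hseg : ∀ t : unitInterval, ∀ H ∈ A.hyps,
        (1 - (t : ℝ)) • (x : V) + (t : ℝ) • (y : V) ∉ H := by
      intro t
      refine mem_compl_iff.2 fun α hα h0 => ?_
      have h1 := h α hα
      have h2 : 0 < α x * α x := mul_self_pos.2 (mem_compl_iff.1 x.2 α hα)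
      have h3 : α x * ((1 - (t : ℝ)) * α x + t * α y) = 0 := by
        rw [map_add, map_smul, map_smul, smul_eq_mul, smul_eq_mul] at h0
        rw [h0, mul_zero]
      have h4 := t.2.1
      have h5 := t.2.2
      rcases h4.eq_or_lt with h6 | h6
      · rw [← h6] at h3
        simp at h3
        simp [h3] at h2
      · nlinarith [mul_pos h6 h1, mul_nonneg (sub_nonneg.2 h5) h2.le]
    let f : unitInterval → {x : V // ∀ H ∈ A.hyps, x ∉ H} := fun t => ⟨_, hseg t⟩
    have hf : Continuous f := by
      refine Continuous.subtype_mk ?_ _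
      fun_prop
    have hf0 : f 0 = x := Subtype.ext (by simp [f])
    have hf1 : f 1 = y := Subtype.ext (by simp [f])
    have hrange := (isPreconnected_range hf).subset_connectedComponent ⟨0, hf0⟩
    exact connectedComponent_eq (hrange ⟨1, hf1⟩)

/-- The chambers correspond to the sign patterns. -/
theorem card_chambers (A : LinArr ℝ V) {m : ℕ} (hm : A.numRegions = m) :
    Nat.card A.Chambers = m := by
  have h1 : (Set.univ : Set A.Chambers).encard = A.numRegions := by
    have h2 : (fun x : {x : V // ∀ H ∈ A.hyps, x ∉ H} => A.pattern x) '' Set.univ =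
        A.pattern '' A.compl := by
      rw [Set.image_univ]
      ext P
      exact ⟨fun ⟨x, h⟩ => ⟨x, x.2, h⟩, fun ⟨x, hx, h⟩ => ⟨⟨x, hx⟩, h⟩⟩
    rw [numRegions, ← h2, ← ConnectedComponents.range_coe, ← Set.image_univ]
    refine encard_image_eq_of_iff _ _ _ fun x _ y _ => ?_
    rw [← connectedComponent_eq_iff, ConnectedComponents.coe_eq_coe]
  rw [← Set.ncard_univ, Set.ncard_def, h1, hm, ENat.toNat_natCast]

end Topology

end LinArr

/-! ### Connected vertex sets of a cycle. -/

section CycleGraph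

variable {n : ℕ}

theorem cycleGraph_adj_cases {u v : Fin n} (h : (SimpleGraph.cycleGraph n).Adj u v) :
    v.val = u.val + 1 ∨ u.val = v.val + 1 ∨ (u.val = 0 ∧ v.val + 1 = n) ∨
      (v.val = 0 ∧ u.val + 1 = n) := by
  have hu := u.2
  have hv := v.2
  rw [SimpleGraph.cycleGraph_adj', Fin.val_sub, Fin.val_sub] at h
  have key : ∀ a b : ℕ, a < n → b < n → (n - b + a) % n = 1 →
      a = b + 1 ∨ (a = 0 ∧ b + 1 = n) := by
    intro a b ha hb h
    rcases lt_or_ge (n - b + a) n with h1 | h1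
    · rw [Nat.mod_eq_of_lt h1] at h
      omega
    · rw [Nat.mod_eq_sub_mod h1, Nat.mod_eq_of_lt (by omega)] at h
      omega
  rcases h with h | h
  · have := key _ _ hu hv h
    omega
  · have := key _ _ hv hu h
    omega

theorem cycleGraph_adj_of_val_eq {u v : Fin n} (h : v.val = u.val + 1) :
    (SimpleGraph.cycleGraph n).Adj u v := by
  have hv := v.2
  rw [SimpleGraph.cycleGraph_adj', Fin.val_sub, Fin.val_sub]
  right
  have : n - u.val + v.val = 1 + n := by omega
  rw [this, Nat.add_mod_right, Nat.mod_eq_of_lt (by omega)]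

theorem cycleGraph_adj_zero_last {u v : Fin n} (hu : u.val = 0) (hv : v.val + 1 = n)
    (hn : 2 ≤ n) : (SimpleGraph.cycleGraph n).Adj u v := by
  rw [SimpleGraph.cycleGraph_adj', Fin.val_sub, Fin.val_sub]
  left
  have : n - v.val + u.val = 1 := by omega
  rw [this, Nat.mod_eq_of_lt (by omega)]

theorem reachable_of_Icc_subset {I : Set (Fin n)} {a : Fin n} (ha : a ∈ I) (d : ℕ) :
    ∀ (b : Fin n) (hb : b ∈ I), b.val = a.val + d → (∀ c, a ≤ c → c ≤ b → c ∈ I) →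
      ((SimpleGraph.cycleGraph n).induce I).Reachable ⟨a, ha⟩ ⟨b, hb⟩ := by
  induction d with
  | zero =>
    intro b hb h _
    obtain rfl : a = b := Fin.ext (by omega)
    exact SimpleGraph.Reachable.refl _
  | succ d ih =>
    intro b hb h hI
    have hbn := b.2
    let c : Fin n := ⟨a.val + d, by omega⟩
    have hc : c ∈ I := hI c (Fin.le_def.2 (by simp [c])) (Fin.le_def.2 (by simp [c]; omega))
    refine (ih c hc rfl fun e h1 h2 => hI e h1 (h2.trans (Fin.le_def.2 ?_))).trans
      (SimpleGraph.Adj.reachable ?_)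
    · simp only [c]
      omega
    · rw [SimpleGraph.induce_adj]
      exact cycleGraph_adj_of_val_eq (by simp only [c]; omega)

theorem reachable_of_le {I : Set (Fin n)} {a b : Fin n} (ha : a ∈ I) (hb : b ∈ I) (hab : a ≤ b)
    (h : ∀ c, a ≤ c → c ≤ b → c ∈ I) :
    ((SimpleGraph.cycleGraph n).induce I).Reachable ⟨a, ha⟩ ⟨b, hb⟩ :=
  reachable_of_Icc_subset ha (b.val - a.val) b hb
    (by have := Fin.le_def.1 hab; omega) h

theorem connected_induce_univ [NeZero n] :
    ((SimpleGraph.cycleGraph n).induce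
      ((Finset.univ : Finset (Fin n)) : Set (Fin n))).Connected := by
  rw [SimpleGraph.connected_iff_exists_forall_reachable]
  exact ⟨⟨0, by simp⟩, fun ⟨w, hw⟩ => reachable_of_le _ _ (Fin.zero_le _) fun _ _ _ => by simp⟩

theorem connected_induce_Ico {i j : Fin n} (hij : i < j) :
    ((SimpleGraph.cycleGraph n).induce (Finset.Ico i j : Set (Fin n))).Connected := by
  rw [SimpleGraph.connected_iff_exists_forall_reachable]
  refine ⟨⟨i, by simpa using hij⟩, fun ⟨w, hw⟩ => ?_⟩
  rw [Finset.mem_coe, Finset.mem_Ico] at hw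
  exact reachable_of_le _ _ hw.1 fun c h1 h2 => by simpa using ⟨h1, h2.trans_lt hw.2⟩

theorem connected_induce_compl_Ico {i j : Fin n} (hij : i < j) :
    ((SimpleGraph.cycleGraph n).induce
      (((Finset.Ico i j)ᶜ : Finset (Fin n)) : Set (Fin n))).Connected := by
  have hj := j.2
  have hij' := Fin.lt_def.1 hij
  have hmem : ∀ c : Fin n, (c < i ∨ j ≤ c) →
      c ∈ (((Finset.Ico i j)ᶜ : Finset (Fin n)) : Set (Fin n)) := by
    intro c hc
    rw [Finset.mem_coe, Finset.mem_compl, Finset.mem_Ico]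
    rintro ⟨h1, h2⟩
    exact hc.elim (fun h => absurd h (not_lt.2 h1)) (fun h => absurd h2 (not_lt.2 h))
  let l : Fin n := ⟨n - 1, by omega⟩
  let o : Fin n := ⟨0, by omega⟩
  have hl : j ≤ l := Fin.le_def.2 (by simp only [l]; omega)
  rw [SimpleGraph.connected_iff_exists_forall_reachable]
  refine ⟨⟨l, hmem l (Or.inr hl)⟩, fun ⟨w, hw⟩ => ?_⟩
  have hw' := hw
  rw [Finset.mem_coe, Finset.mem_compl, Finset.mem_Ico, not_and, not_lt] at hw'
  rcases lt_or_ge w i with h | h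
  · have ho : o < i := Fin.lt_def.2 (by have := Fin.lt_def.1 h; simp only [o]; omega)
    refine SimpleGraph.Reachable.trans (v := ⟨o, hmem o (Or.inl ho)⟩)
      (SimpleGraph.Adj.reachable ?_) (reachable_of_le _ _ (Fin.le_def.2 (Nat.zero_le _))
        fun c _ h2 => hmem c (Or.inl (h2.trans_lt h)))
    rw [SimpleGraph.induce_adj]
    exact (cycleGraph_adj_zero_last rfl (by simp only [l]; omega) (by omega)).symm
  · refine (reachable_of_le _ _ (Fin.le_def.2 (by have := w.2; simp only [l]; omega))
      fun c h1 _ => hmem c (Or.inr ((hw' h).trans h1))).symm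

theorem SimpleGraph.Connected.forall_of_adj {V : Type*} {G : SimpleGraph V} (hG : G.Connected)
    {P : V → Prop} (hP : ∀ u v, G.Adj u v → P u → P v) {a : V} (ha : P a) (b : V) : P b := by
  obtain ⟨p⟩ := hG.preconnected a b
  induction p with
  | nil => exact ha
  | cons h _ ih => exact ih (hP _ _ h ha)

/-- The right end of the half-open interval is the successor of the maximum, which is a vertex
because the last vertex is not in `J`. -/
theorem exists_eq_Ico {J : Finset (Fin n)} (hJ : J.Nonempty)
    (hlast : ∀ l ∈ J, l.val + 1 ≠ n)
    (hconv : ∀ a ∈ J, ∀ c ∈ J, ∀ b, a < b → b < c → b ∈ J) : ∃ i j, i < j ∧ J = Finset.Ico i j := by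
  have h1 := J.min'_mem hJ
  have h2 := J.max'_mem hJ
  have h3 := hlast _ h2
  have h4 := (J.max' hJ).2
  refine ⟨J.min' hJ, ⟨(J.max' hJ).val + 1, by omega⟩, ?_, ?_⟩
  · have := Fin.le_def.1 (J.min'_le _ h2)
    rw [Fin.lt_def]
    dsimp only
    omega
  · ext b
    rw [Finset.mem_Ico, Fin.lt_def]
    dsimp only
    constructor
    · intro hb
      exact ⟨J.min'_le b hb, Nat.lt_succ_of_le (Fin.le_def.1 (J.le_max' b hb))⟩
    · rintro ⟨h5, h6⟩
      rcases h5.eq_or_lt with h7 | h7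
      · rwa [← h7]
      · rcases (Fin.le_def.2 (Nat.lt_succ_iff.1 h6) : b ≤ J.max' hJ).eq_or_lt with h8 | h8
        · rwa [h8]
        · exact hconv _ h1 _ h2 b h7 h8

/-- The connected vertex sets of a cycle are the arcs. -/
theorem connected_induce_cycleGraph_iff [NeZero n] (I : Finset (Fin n)) :
    (I.Nonempty ∧ ((SimpleGraph.cycleGraph n).induce (I : Set (Fin n))).Connected) ↔
      I = Finset.univ ∨ ∃ i j : Fin n, i < j ∧ (I = Finset.Ico i j ∨ I = (Finset.Ico i j)ᶜ) := by
  constructor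
  · rintro ⟨hne, hconn⟩
    -- As `j : Fin n`, no `Ico i j` contains the last vertex. So arcs avoiding it are intervals, and
    -- proper arcs containing it are complements of intervals.
    by_cases hlast : ∀ l ∈ I, l.val + 1 ≠ n
    · obtain ⟨i, j, hij, hI⟩ := exists_eq_Ico hne hlast (by
        intro a ha c hc b hab hbc
        by_contra hb
        -- No edge within `I` jumps over the missing vertex `b`: the only other connection is the
        -- edge from `0` to the last vertex, which is not in `I`.
        have := hconn.forall_of_adj (P := fun x => x.val < b) (a := ⟨a, ha⟩) (by
          rintro ⟨u, hu⟩ ⟨v, hv⟩ h hub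
          rw [SimpleGraph.induce_adj] at h
          have h1 := cycleGraph_adj_cases h
          have h2 := hlast u hu
          have h3 := hlast v hv
          have h4 : v ≠ b := fun h => hb (h ▸ hv)
          simp only [Fin.lt_def, ne_eq, Fin.ext_iff] at *
          omega) hab ⟨c, hc⟩
        exact absurd this (not_lt.2 hbc.le))
      exact Or.inr ⟨i, j, hij, Or.inl hI⟩
    · push Not at hlast
      obtain ⟨l, hl, hln⟩ := hlast
      by_cases huniv : I = Finset.univ
      · exact Or.inl huniv
      have hne' : Iᶜ.Nonempty := by
        rw [Finset.nonempty_iff_ne_empty]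
        simpa using huniv
      obtain ⟨i, j, hij, hI⟩ := exists_eq_Ico hne' (by
        intro l' hl' h
        rw [Finset.mem_compl] at hl'
        apply hl'
        rwa [show l' = l from Fin.ext (by omega)]) (by
        intro a ha c hc b hab hbc
        rw [Finset.mem_compl] at ha hc ⊢
        intro hb
        -- No edge within `I` leaves the gap between the missing vertices `a` and `c`, so the last
        -- vertex, which lies in `I`, would be below `c`.
        have := hconn.forall_of_adj (P := fun x => a < x.val ∧ x.val < c) (a := ⟨b, hb⟩) (by
          rintro ⟨u, hu⟩ ⟨v, hv⟩ h ⟨hu1, hu2⟩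
          rw [SimpleGraph.induce_adj] at h
          have h1 := cycleGraph_adj_cases h
          have h3 : v ≠ a := fun h => ha (h ▸ hv)
          have h4 : v ≠ c := fun h => hc (h ▸ hv)
          have h5 := c.2
          simp only [Fin.lt_def, ne_eq, Fin.ext_iff] at *
          omega) ⟨hab, hbc⟩ ⟨l, hl⟩
        have h6 := Fin.lt_def.1 this.2
        have h7 := c.2
        dsimp only at h6
        omega)
      exact Or.inr ⟨i, j, hij, Or.inr (by rw [← hI, compl_compl])⟩
  · rintro (rfl | ⟨i, j, hij, rfl | rfl⟩)
    · exact ⟨Finset.univ_nonempty, connected_induce_univ⟩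
    · exact ⟨⟨i, by simpa using hij⟩, connected_induce_Ico hij⟩
    · exact ⟨⟨j, by simp⟩, connected_induce_compl_Ico hij⟩

end CycleGraph

/-! ### The arrangement of the cycle in terms of partial sums. -/

section CycleArrangement

variable (F : Type*) [Field F] {n : ℕ}

theorem coordSum_apply (I : Finset (Fin n)) (x : Fin n → F) :
    coordSum F I x = ∑ i ∈ I, x i := by
  simp [coordSum, LinearMap.sum_apply]

theorem coordSum_Ico {i j : Fin n} (hij : i ≤ j) :
    coordSum F (Finset.Ico i j) = coordSum F (Finset.Iio j) - coordSum F (Finset.Iio i) := by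
  have h : Finset.Ico i j = Finset.Iio j \ Finset.Iio i := by
    ext x
    simp [and_comm]
  rw [h, eq_sub_iff_add_eq, coordSum, coordSum, coordSum]
  exact Finset.sum_sdiff (Finset.Iio_subset_Iio hij)

theorem coordSum_compl (I : Finset (Fin n)) :
    coordSum F Iᶜ = coordSum F Finset.univ - coordSum F I := by
  rw [eq_sub_iff_add_eq, add_comm]
  exact Finset.sum_add_sum_compl I _

/-- The connected subgraph arrangement of a cycle as a Shi arrangement. -/
theorem connSubgraphArr_cycleGraph_hyps [NeZero n] :
    (connSubgraphArr F (SimpleGraph.cycleGraph n)).hyps =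
      LinArr.shiHyps (coordSum F Finset.univ) (fun i : Fin n => coordSum F (Finset.Iio i))
        Finset.univ 0 := by
  have hcompl : ∀ i j : Fin n, i < j → LinearMap.ker (coordSum F (Finset.Ico i j)ᶜ) =
      LinearMap.ker (coordSum F (Finset.Iio j) - coordSum F (Finset.Iio i) -
        coordSum F Finset.univ) := by
    intro i j hij
    rw [coordSum_compl, coordSum_Ico F hij.le, LinArr.ker_sub_comm]
  ext K
  constructor
  · rintro ⟨I, hI, hconn, rfl⟩
    rcases (connected_induce_cycleGraph_iff I).1 ⟨hI, hconn⟩ with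
      rfl | ⟨i, j, hij, rfl | rfl⟩
    · exact Or.inl rfl
    · exact Or.inr (Or.inl ⟨i, Finset.mem_univ _, j, Finset.mem_univ _, hij,
        Or.inl (by rw [coordSum_Ico F hij.le])⟩)
    · exact Or.inr (Or.inl ⟨i, Finset.mem_univ _, j, Finset.mem_univ _, hij,
        Or.inr (hcompl i j hij)⟩)
  · rintro (rfl | ⟨i, -, j, -, hij, rfl | rfl⟩ | ⟨i, -, c, hc, -⟩)
    · obtain ⟨h1, h2⟩ := (connected_induce_cycleGraph_iff (n := n) Finset.univ).2 (Or.inl rfl)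
      exact ⟨_, h1, h2, rfl⟩
    · obtain ⟨h1, h2⟩ := (connected_induce_cycleGraph_iff _).2
        (Or.inr ⟨i, j, hij, Or.inl rfl⟩)
      exact ⟨_, h1, h2, by rw [coordSum_Ico F hij.le]⟩
    · obtain ⟨h1, h2⟩ := (connected_induce_cycleGraph_iff _).2
        (Or.inr ⟨i, j, hij, Or.inr rfl⟩)
      exact ⟨_, h1, h2, (hcompl i j hij).symm⟩
    · exact absurd hc (Nat.not_lt_zero _)

/-- The vector of consecutive differences of a sequence. -/
def diffVec {F : Type*} [Field F] (n : ℕ) (c : ℕ → F) : Fin n → F :=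
  fun k => c (k.val + 1) - c k.val

theorem coordSum_univ_diffVec (c : ℕ → F) :
    coordSum F Finset.univ (diffVec n c) = c n - c 0 := by
  rw [coordSum_apply]
  simp only [diffVec]
  rw [Fin.sum_univ_eq_sum_range (fun k => c (k + 1) - c k) n, Finset.sum_range_sub]

theorem coordSum_Iio_diffVec (c : ℕ → F) (i : Fin n) :
    coordSum F (Finset.Iio i) (diffVec n c) = c i - c 0 := by
  rw [coordSum_apply]
  have h := Finset.sum_map (Finset.Iio i) Fin.valEmbedding (fun k => c (k + 1) - c k)
  rw [Fin.map_valEmbedding_Iio, Nat.Iio_eq_range, Finset.sum_range_sub] at h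
  exact h.symm

/-- A vector is determined by its partial sums; these are chosen as `b k - b 0` for `k < n`,
starting at `0`, and `a` at `n`. -/
theorem affIndep_coordSum [NeZero n] :
    LinArr.AffIndep (coordSum F Finset.univ) (fun i : Fin n => coordSum F (Finset.Iio i))
      Finset.univ := by
  intro a b
  let c : ℕ → F := fun k => if h : k < n then b ⟨k, h⟩ - b 0 else a
  have hc0 : c 0 = 0 := by simp [c, Nat.pos_of_neZero]
  refine ⟨diffVec n c, ?_, fun i _ j _ => ?_⟩
  · rw [coordSum_univ_diffVec, hc0]
    simp [c]
  · rw [coordSum_Iio_diffVec, coordSum_Iio_diffVec]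
    simp [c]

theorem isGood_cycleGraph [CharZero F] (hn : 1 ≤ n) :
    (connSubgraphArr F (SimpleGraph.cycleGraph n)).IsGood
      (1 ::ₘ Multiset.replicate (n - 1) n) := by
  have : NeZero n := ⟨by omega⟩
  obtain ⟨r, rfl⟩ : ∃ r, n = r + 1 := ⟨n - 1, by omega⟩
  have := LinArr.unpinnedGood_of_pinnedGood (LinArr.pinnedGood (F := F) (ι := Fin (r + 1)) r 2 0
    one_le_two) _ _ _ _ 0 _ (by simp) (by simp) (affIndep_coordSum F)
    (connSubgraphArr_cycleGraph_hyps F)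
  simpa using this

end CycleArrangement

/-! ### The isomorphism with the cone of the Shi arrangement. -/

section ShiCone

/-- The hyperplanes of the cone of the Shi arrangement. -/
theorem cone_shiArr_hyps (n : ℕ) :
    (cone (shiArr n)).hyps = LinArr.shiHyps
      (LinearMap.proj (Fin.last n) : Module.Dual ℚ (Fin (n + 1) → ℚ))
      (fun i : Fin n => -(LinearMap.proj i.castSucc : Module.Dual ℚ (Fin (n + 1) → ℚ)))
      Finset.univ 0 := by
  have h : ∀ i j : Fin n, coordDiff ℚ i.castSucc j.castSucc =
      -(LinearMap.proj j.castSucc : Module.Dual ℚ (Fin (n + 1) → ℚ)) -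
        -LinearMap.proj i.castSucc := by
    intro i j
    rw [coordDiff]
    abel
  ext K
  rw [mem_cone_shiArr]
  constructor
  · rintro (h1 | ⟨i, j, hij, h1⟩)
    · exact Or.inl h1
    · exact Or.inr (Or.inl ⟨i, Finset.mem_univ _, j, Finset.mem_univ _, hij, by rwa [h] at h1⟩)
  · rintro (h1 | ⟨i, -, j, -, hij, h1⟩ | ⟨i, -, c, hc, -⟩)
    · exact Or.inl h1
    · exact Or.inr ⟨i, j, hij, by rwa [h]⟩
    · exact absurd hc (Nat.not_lt_zero _)

variable {F : Type*} [Field F]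

theorem image_mapHyp_shiHyps {V W ι : Type*} [AddCommGroup V] [Module F V] [AddCommGroup W]
    [Module F W] [LinearOrder ι] (φ : Module.Dual F V →ₗ[F] Module.Dual F W)
    {z : Module.Dual F V} {y : ι → Module.Dual F V} {z' : Module.Dual F W}
    {y' : ι → Module.Dual F W} {s : Finset ι} (hz : φ z = z')
    (hy : ∀ i j, φ (y j - y i) = y' j - y' i) :
    mapHyp φ '' LinArr.shiHyps z y s 0 = LinArr.shiHyps z' y' s 0 := by
  subst hz
  ext L
  constructor
  · rintro ⟨K, rfl | ⟨i, hi, j, hj, hij, rfl | rfl⟩ | ⟨i, -, c, hc, -⟩, rfl⟩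
    · exact Or.inl (mapHyp_ker φ z)
    · exact Or.inr (Or.inl ⟨i, hi, j, hj, hij, Or.inl (by rw [mapHyp_ker, hy])⟩)
    · exact Or.inr (Or.inl ⟨i, hi, j, hj, hij, Or.inr (by rw [mapHyp_ker, map_sub, hy])⟩)
    · exact absurd hc (Nat.not_lt_zero _)
  · rintro (rfl | ⟨i, hi, j, hj, hij, rfl | rfl⟩ | ⟨i, -, c, hc, -⟩)
    · exact ⟨_, Or.inl rfl, mapHyp_ker φ z⟩
    · exact ⟨_, Or.inr (Or.inl ⟨i, hi, j, hj, hij, Or.inl rfl⟩), by rw [mapHyp_ker, hy]⟩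
    · exact ⟨_, Or.inr (Or.inl ⟨i, hi, j, hj, hij, Or.inr rfl⟩), by
        rw [mapHyp_ker, map_sub, hy]⟩
    · exact absurd hc (Nat.not_lt_zero _)

theorem injOn_mapHyp {V W : Type*} [AddCommGroup V] [Module F V] [AddCommGroup W]
    [Module F W] (φ : Module.Dual F V →ₗ[F] Module.Dual F W) (hφ : Function.Injective φ)
    (A : LinArr F V) : Set.InjOn (mapHyp φ) A.hyps := by
  intro K hK L hL h
  obtain ⟨α, hα, rfl⟩ := A.isHyperplane K hK
  obtain ⟨β, hβ, rfl⟩ := A.isHyperplane L hL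
  rw [mapHyp_ker, mapHyp_ker] at h
  obtain ⟨c, hc⟩ := LinArr.exists_smul_of_ker_le h.le
  rw [← map_smul] at hc
  obtain rfl := hφ hc
  exact LinArr.ker_eq_of_ker_le hβ fun x hx => by
    rw [LinearMap.mem_ker] at hx ⊢
    rw [LinearMap.smul_apply, hx, smul_zero]

/-- The sequence `w_0 - w_k`, followed by the last coordinate of `w`. -/
def shiSeq (n : ℕ) [NeZero n] (k : ℕ) : Module.Dual F (Fin (n + 1) → F) :=
  if h : k < n then
    (LinearMap.proj (Fin.castSucc (0 : Fin n)) : Module.Dual F (Fin (n + 1) → F)) -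
      LinearMap.proj (Fin.castSucc ⟨k, h⟩)
  else LinearMap.proj (Fin.last n)

/-- The linear map `F^{n+1} → F^n` that identifies the cone of the Shi arrangement with the
connected subgraph arrangement of the cycle. -/
def shiMap (n : ℕ) [NeZero n] : (Fin (n + 1) → F) →ₗ[F] (Fin n → F) :=
  LinearMap.pi fun k => shiSeq n (k.val + 1) - shiSeq n k.val

theorem shiMap_apply (n : ℕ) [NeZero n] (w : Fin (n + 1) → F) :
    shiMap n w = diffVec n fun k => shiSeq n k w := rfl

theorem shiSeq_zero (n : ℕ) [NeZero n] (w : Fin (n + 1) → F) : shiSeq n 0 w = 0 := by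
  simp [shiSeq, Nat.pos_of_neZero]

theorem shiMap_surjective (n : ℕ) [NeZero n] :
    Function.Surjective (shiMap n : (Fin (n + 1) → F) →ₗ[F] (Fin n → F)) := by
  intro x
  let x' : ℕ → F := fun k => if h : k < n then x ⟨k, h⟩ else 0
  let P : ℕ → F := fun k => ∑ l ∈ Finset.range k, x' l
  -- Since `P 0 = 0`, the sequence attached to this vector is `P`, the partial sums of `x`, whose
  -- differences return `x`.
  refine ⟨Fin.snoc (fun i : Fin n => -P i) (P n), ?_⟩
  have hseq : ∀ k, k ≤ n →
      shiSeq n k (Fin.snoc (fun i : Fin n => -P i) (P n) : Fin (n + 1) → F) = P k := by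
    intro k hk
    rcases hk.lt_or_eq with h | rfl
    · rw [shiSeq, dif_pos h, LinearMap.sub_apply, LinearMap.proj_apply, LinearMap.proj_apply,
        Fin.snoc_castSucc, Fin.snoc_castSucc]
      simp [P]
    · simp [shiSeq]
  funext k
  rw [shiMap_apply, diffVec, hseq _ k.2, hseq _ k.2.le]
  simp only [P, Finset.sum_range_succ, add_sub_cancel_left]
  simp [x']

/-- The map `φ` is dual to the surjection `shiMap`, hence injective. It sends `z` to the last
coordinate and `y_i` to `w_0 - w_i`; in differences `w_0` drops out and `w_i - w_j` remains. -/
theorem exists_shi_isomorphism (n : ℕ) (hn : 1 ≤ n) :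
    ∃ φ : Module.Dual ℚ (Fin n → ℚ) →ₗ[ℚ] Module.Dual ℚ (Fin (n + 1) → ℚ),
      Function.Injective φ ∧
      Set.BijOn (mapHyp φ) (connSubgraphArr ℚ (SimpleGraph.cycleGraph n)).hyps
        (cone (shiArr n)).hyps := by
  have : NeZero n := ⟨by omega⟩
  have hinj : Function.Injective (shiMap n : (Fin (n + 1) → ℚ) →ₗ[ℚ] (Fin n → ℚ)).dualMap :=
    LinearMap.dualMap_injective_of_surjective (shiMap_surjective n)
  refine ⟨_, hinj, ?_⟩
  have himage := image_mapHyp_shiHyps (shiMap n : (Fin (n + 1) → ℚ) →ₗ[ℚ] (Fin n → ℚ)).dualMap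
    (z := coordSum ℚ Finset.univ) (y := fun i : Fin n => coordSum ℚ (Finset.Iio i))
    (z' := LinearMap.proj (Fin.last n)) (y' := fun i : Fin n => -LinearMap.proj i.castSucc)
    (s := Finset.univ)
    (LinearMap.ext fun w => by
      rw [LinearMap.dualMap_apply, shiMap_apply, coordSum_univ_diffVec, shiSeq_zero]
      simp [shiSeq])
    (fun i j => LinearMap.ext fun w => by
      rw [LinearMap.dualMap_apply, shiMap_apply, LinearMap.sub_apply, coordSum_Iio_diffVec,
        coordSum_Iio_diffVec]
      simp [shiSeq]
      ring)
  rw [← connSubgraphArr_cycleGraph_hyps, ← cone_shiArr_hyps] at himage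
  rw [← himage]
  exact (injOn_mapHyp _ hinj _).bijOn_image

end ShiCone

end

theorem mainTheorem4 (n : ℕ) (hn : 1 ≤ n) :
    (∃ φ : Module.Dual ℚ (Fin n → ℚ) →ₗ[ℚ] Module.Dual ℚ (Fin (n + 1) → ℚ),
      Function.Injective φ ∧
      Set.BijOn (mapHyp φ) (connSubgraphArr ℚ (SimpleGraph.cycleGraph n)).hyps
        (cone (shiArr n)).hyps) ∧
    (connSubgraphArr ℚ (SimpleGraph.cycleGraph n)).InductivelyFree ∧
    (connSubgraphArr ℚ (SimpleGraph.cycleGraph n)).FreeWithExponents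
      (1 ::ₘ Multiset.replicate (n - 1) n) ∧
    ∃ χ : Polynomial ℤ,
      (∀ p : Polynomial ℤ,
        (connSubgraphArr ℚ (SimpleGraph.cycleGraph n)).IsCharPoly p ↔ p = χ) ∧
      χ = (Polynomial.X - 1) * (Polynomial.X - (n : Polynomial ℤ)) ^ (n - 1) ∧
      (Nat.card (connSubgraphArr ℝ (SimpleGraph.cycleGraph n)).Chambers : ℤ) =
        (-1) ^ n * χ.eval (-1) ∧
      Nat.card (connSubgraphArr ℝ (SimpleGraph.cycleGraph n)).Chambers =
        2 * (n + 1) ^ (n - 1) := by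
  have hprod : ((1 ::ₘ Multiset.replicate (n - 1) n).map
      fun i : ℕ => Polynomial.X - (i : Polynomial ℤ)).prod =
      (Polynomial.X - 1) * (Polynomial.X - (n : Polynomial ℤ)) ^ (n - 1) := by
    simp
  have hQ := isGood_cycleGraph ℚ hn
  -- The exponents are the same over every field of characteristic zero, so the polynomial computed
  -- over `ℚ` also counts the real chambers.
  have hR := isGood_cycleGraph ℝ hn
  have hQχ := hQ.charPoly
  have hRχ := hR.charPoly
  rw [hprod] at hQχ hRχ
  obtain ⟨-, m, hm, hmχ⟩ := hRχ.numRegions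
  rw [Module.finrank_fin_fun] at hmχ
  have hcard := LinArr.card_chambers _ hm
  refine ⟨exists_shi_isomorphism n hn, hQ.inductivelyFree, hQ.free, _,
    fun p => ⟨fun hp => hp.unique hQχ, fun hp => hp ▸ hQχ⟩, rfl, ?_, ?_⟩
  · rw [hcard, hmχ]
  · rw [hcard]
    have heval : (-1 : ℤ) ^ n * ((Polynomial.X - 1) *
        (Polynomial.X - (n : Polynomial ℤ)) ^ (n - 1)).eval (-1) = 2 * (n + 1) ^ (n - 1) := by
      obtain ⟨r, rfl⟩ : ∃ r, n = r + 1 := ⟨n - 1, by omega⟩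
      simp only [Polynomial.eval_mul, Polynomial.eval_sub, Polynomial.eval_X,
        Polynomial.eval_one, Polynomial.eval_pow, Polynomial.eval_natCast,
        Nat.add_sub_cancel]
      rw [show (-1 : ℤ) - ((r + 1 : ℕ) : ℤ) = -1 * (((r + 1 : ℕ) : ℤ) + 1) by ring, mul_pow,
        pow_succ]
      have h1 : (-1 : ℤ) ^ r * (-1) ^ r = 1 := by rw [← mul_pow]; simp
      linear_combination (2 * (((r + 1 : ℕ) : ℤ) + 1) ^ r) * h1
    rw [heval] at hmχ
    exact_mod_cast hmχ
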